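/- **Setting.** Let $R>0$ and $n\ge 1$. For a probability measure $\mu$ on $[-R,R]^d$, the Boltzmann–Gibbs entropy is $H(\mu)=-\int_{[-R,R]^d}p\log p\,d\mathbf x\in[-\infty,\infty)$ if $\mu$ has a density $p$ with respect to Lebesgue measure, and $H(\mu)=-\infty$ otherwise. For $\mathbf x\in\mathbb R^N$ put $\kappa_N(\mathbf x)=\frac1N\sum_{j=1}^N x_j$. For probability measures $\mu_1,\dots,\mu_n$ on $[-R,R]$, an *approximating sequence* is a sequence $\Xi(N)=(\xi_1(N),\dots,\xi_n(N))$, $N\in\mathbb N$, of $n$-tuples of vectors $\xi_i(N)\in[-R,R]^N$ with increasing coordinates such that $\frac1N\sum_{j}\xi_i(N)_j^k\to\int x^k\,d\mu_i(x)$ as $N\to\infty$ for all $k$ and $i$; such sequences exist. The symmetric group acts by $\sigma(\mathbf x)=(x_{\sigma^{-1}(1)},\dots,x_{\sigma^{-1}(N)})$. For $h\in C_{\mathbb R}([-R,R]^n)$ the *mutual pressure* is $$P_{\mathrm{sym}}(h:\mu_1,\dots,\mu_n)=\limsup_{N\to\infty}\frac1N\log\Bigl[\frac1{(N!)^n}\sum_{\sigma_1,\dots,\sigma_n\in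 S_N}\exp\Bigl(\sum_{j=1}^N h\bigl(\sigma_1(\xi_1(N))_j,\dots,\sigma_n(\xi_n(N))_j\bigr)\Bigr)\Bigr].$$ For a probability measure $\mu$ on $[-R,R]^n$ with marginals $\mu_1,\dots,\mu_n$, its Legendre transform is $$\mathcal I_{\mathrm{sym}}(\mu)=\sup\{\mu(h)-P_{\mathrm{sym}}(h:\mu_1,\dots,\mu_n):h\in C_{\mathbb R}([-R,R]^n)\}.$$ Let $\Delta_{\mathrm{sym}}(\mu:\Xi(N);N,m,\delta)$ be the set of $(\sigma_1,\dots,\sigma_n)\in S_N^n$ such that the vectors $\mathbf x_i=\sigma_i(\xi_i(N))$ satisfy $|\kappa_N(\mathbf x_{i_1}\cdots\mathbf x_{i_k})-\int x_{i_1}\cdots x_{i_k}\,d\mu|<\delta$ (with pointwise products) for all $i_1,\dots,i_k\in\{1,\dots,n\}$ and $1\le k\le m$, and put $$I_{\mathrm{sym}}(\mu)=-\lim_{m\to\infty,\,\delta\searrow0}\ \limsup_{N\to\infty}\frac1N\log\frac{\#\Delta_{\mathrm{sym}}(\mu:\Xi(N);N,m,\delta)}{(N!)^n}\qquad(\log 0=-\infty).$$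 **Theorem 3.5.** For every probability measure $\mu$ on $[-R,R]^n$ with marginals $\mu_1,\dots,\mu_n$, and for any choice of the approximating sequences for $(\mu_1,\dots,\mu_n)$ used to compute $\mathcal I_{\mathrm{sym}}(\mu)$ and $I_{\mathrm{sym}}(\mu)$, $$H(\mu)=-\mathcal I_{\mathrm{sym}}(\mu)+\sum_{i=1}^nH(\mu_i)$$ in $[-\infty,\infty)$. Moreover, if $H(\mu_i)>-\infty$ for all $i=1,\dots,n$, then $$\mathcal I_{\mathrm{sym}}(\mu)=I_{\mathrm{sym}}(\mu)=S(\mu,\mu_1\otimes\cdots\otimes\mu_n),$$ where $S(\mu,\nu)\in[0,\infty]$ is the relative entropy (Kullback–Leibler divergence) of $\mu$ with respect to $\nu$, and $\mathcal I_{\mathrm{sym}}(\mu)=0$ if and only if $\mu=\mu_1\otimes\cdots\otimes\mu_n$, i.e., if and only if the coordinate variables $x_1,\dots,x_n$ are independent with respect to $\mu$. -/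

import Mathlib

open MeasureTheory Filter Topology

namespace MutualPressure

noncomputable section

/-- The interval `[-R, R]`. -/
abbrev Interval (R : ℝ) : Type := Set.Icc (-R) R

/-- The box `[-R, R]^n`. -/
abbrev Box (R : ℝ) (n : ℕ) : Type := Fin n → Interval R

/-- Lebesgue measure on `[-R, R]`. -/
def lebesgueInterval (R : ℝ) : Measure (Interval R) := Measure.comap Subtype.val volume

/-- Lebesgue measure on `[-R, R]^n`. -/
def lebesgueBox (R : ℝ) (n : ℕ) : Measure (Box R n) := Measure.pi fun _ => lebesgueInterval R

open Classical in
/-- Boltzmann-Gibbs entropy `H(μ) = -∫ p log p dL` if `μ` has a density `p` with respect to the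
reference measure `L`, and `-∞` otherwise. It is used for probability measures `μ` and finite
`L`; then `p log p ≥ -1/e`, so if `p log p` is not integrable, `∫ p log p dL = +∞` and
`H(μ) = -∞`. -/
def entropy {X : Type*} [MeasurableSpace X] (L μ : Measure X) : EReal :=
  if μ ≪ L ∧
      Integrable (fun x => (μ.rnDeriv L x).toReal * Real.log (μ.rnDeriv L x).toReal) L
  then ((-∫ x, (μ.rnDeriv L x).toReal * Real.log (μ.rnDeriv L x).toReal ∂L : ℝ) : EReal)
  else ⊥

/-- `H(μ)` for `μ` on `[-R, R]^n`. -/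
def entropyBox {R : ℝ} {n : ℕ} (μ : Measure (Box R n)) : EReal := entropy (lebesgueBox R n) μ

/-- `H(ν)` for `ν` on `[-R, R]`. -/
def entropyInterval {R : ℝ} (ν : Measure (Interval R)) : EReal := entropy (lebesgueInterval R) ν

/-- The `i`-th marginal of a measure on `[-R, R]^n`. -/
def marginal {R : ℝ} {n : ℕ} (μ : Measure (Box R n)) (i : Fin n) : Measure (Interval R) :=
  μ.map (fun x => x i)

/-- The mean value `κ_N(x) = (1/N) ∑_j x_j`. -/
def kappa {N : ℕ} (x : Fin N → ℝ) : ℝ := (1 / (N : ℝ)) * ∑ j, x j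

/-- `Ξ(N) = (ξ_1(N), …, ξ_n(N))` is an approximating sequence for `(ν_1, …, ν_n)`: each
`ξ_i(N) ∈ [-R, R]^N` has increasing coordinates, and `ξ_i(N) → ν_i` in moments. -/
structure IsApproximating {R : ℝ} {n : ℕ} (ν : Fin n → Measure (Interval R))
    (Ξ : (N : ℕ) → Fin n → Fin N → Interval R) : Prop where
  monotone : ∀ N i, Monotone (Ξ N i)
  tendsto_moment : ∀ (i : Fin n) (k : ℕ),
    Tendsto (fun N => kappa (fun j => (Ξ N i j : ℝ) ^ k)) atTop (𝓝 (∫ x, (x : ℝ) ^ k ∂(ν i)))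

/-- The action `(σ_1(ξ_1), …, σ_n(ξ_n))` of `S_N^n`, where
`σ(x) = (x_{σ⁻¹(1)}, …, x_{σ⁻¹(N)})`. -/
def permute {R : ℝ} {n N : ℕ} (σ : Fin n → Equiv.Perm (Fin N)) (ξ : Fin n → Fin N → Interval R) :
    Fin n → Fin N → Interval R :=
  fun i j => ξ i ((σ i)⁻¹ j)

/-- The set `Δ_R(μ; N, m, δ)` of microstates whose mixed moments up to order `m` are
`δ`-close to those of `μ`. -/
def microstates {R : ℝ} {n : ℕ} (μ : Measure (Box R n)) (N m : ℕ) (δ : ℝ) :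
    Set (Fin n → Fin N → Interval R) :=
  {x | ∀ k : ℕ, 1 ≤ k → k ≤ m → ∀ i : Fin k → Fin n,
    |kappa (fun j => ∏ l, (x (i l) j : ℝ)) - ∫ y, ∏ l, (y (i l) : ℝ) ∂μ| < δ}

/-- The set `Δ_sym(μ : Ξ(N); N, m, δ)` of discrete microstates. -/
def symMicrostates {R : ℝ} {n : ℕ} (μ : Measure (Box R n))
    (Ξ : (N : ℕ) → Fin n → Fin N → Interval R) (N m : ℕ) (δ : ℝ) :
    Set (Fin n → Equiv.Perm (Fin N)) :=
  {σ | permute σ (Ξ N) ∈ microstates μ N m δ}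

/-- `limsup_N (1/N) log γ_{S_N}^{⊗ n}(Δ_sym(μ : Ξ(N); N, m, δ))`, with `log 0 = -∞`, where
`γ_{S_N}` is the uniform probability measure on `S_N`. -/
def symRate {R : ℝ} {n : ℕ} (μ : Measure (Box R n))
    (Ξ : (N : ℕ) → Fin n → Fin N → Interval R) (m : ℕ) (δ : ℝ) : EReal :=
  limsup (fun N : ℕ =>
    (((1 / (N : ℝ)) : ℝ) : EReal) *
      ENNReal.log (((symMicrostates μ Ξ N m δ).ncard : ENNReal) / ((N.factorial : ENNReal) ^ n)))
    atTop

/-- `I_sym(μ) = -lim_{m → ∞, δ ↘ 0} limsup_N (1/N) log γ_{S_N}^{⊗ n}(Δ_sym(μ : Ξ(N); N, m, δ))`,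
computed along `Ξ`. The limit is monotone, so it is written as an infimum;
see `tendsto_symRate`. -/
def ISym {R : ℝ} {n : ℕ} (μ : Measure (Box R n))
    (Ξ : (N : ℕ) → Fin n → Fin N → Interval R) : EReal :=
  -⨅ (m : ℕ) (δ : ℝ) (_ : 0 < δ), symRate μ Ξ m δ

/-- The mutual pressure `P_sym(h : ν_1, …, ν_n)`, computed along an approximating sequence `Ξ`
for `(ν_1, …, ν_n)`. -/
def mutualPressure {R : ℝ} {n : ℕ} (Ξ : (N : ℕ) → Fin n → Fin N → Interval R)
    (h : C(Box R n, ℝ)) : EReal :=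
  limsup (fun N : ℕ =>
    (((1 / (N : ℝ)) * Real.log ((1 / ((N.factorial : ℝ) ^ n)) *
      ∑ σ : Fin n → Equiv.Perm (Fin N),
        Real.exp ((N : ℝ) * kappa (fun j => h (fun i => permute σ (Ξ N) i j)))) : ℝ) : EReal))
    atTop

/-- The Legendre transform of the mutual pressure,
`𝓘_sym(μ) = sup {μ(h) - P_sym(h : μ_1, …, μ_n) : h ∈ C_ℝ([-R, R]^n)}`, computed along an
approximating sequence `Ξ` for the marginals of `μ`. -/
def legendreISym {R : ℝ} {n : ℕ} (μ : Measure (Box R n))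
    (Ξ : (N : ℕ) → Fin n → Fin N → Interval R) : EReal :=
  ⨆ h : C(Box R n, ℝ), ((∫ x, h x ∂μ : ℝ) : EReal) - mutualPressure Ξ h

theorem symRate_mono {R : ℝ} {n : ℕ} (μ : Measure (Box R n))
    (Ξ : (N : ℕ) → Fin n → Fin N → Interval R) {m m' : ℕ} {δ δ' : ℝ} (hm : m' ≤ m)
    (hδ : δ ≤ δ') : symRate μ Ξ m δ ≤ symRate μ Ξ m' δ' := by
  refine limsup_le_limsup (Eventually.of_forall fun N => ?_)
  refine mul_le_mul_of_nonneg_left (ENNReal.log_monotone ?_) (by positivity)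
  refine ENNReal.div_le_div_right ?_ _
  have hs : symMicrostates μ Ξ N m δ ⊆ symMicrostates μ Ξ N m' δ' :=
    fun σ hσ k hk hk' i => (hσ k hk (hk'.trans hm) i).trans_le hδ
  exact_mod_cast Set.ncard_le_ncard hs (Set.toFinite _)

/-- The infimum in the definition of `ISym` is the limit as `m → ∞`, `δ ↘ 0`. -/
theorem tendsto_symRate {R : ℝ} {n : ℕ} (μ : Measure (Box R n))
    (Ξ : (N : ℕ) → Fin n → Fin N → Interval R) :
    Tendsto (fun p : ℕ × ℝ => symRate μ Ξ p.1 p.2) (atTop ×ˢ 𝓝[>] 0) (𝓝 (-ISym μ Ξ)) := by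
  rw [ISym, neg_neg]
  refine tendsto_order.2 ⟨fun a ha => ?_, fun a ha => ?_⟩
  · have : ∀ᶠ p : ℕ × ℝ in atTop ×ˢ 𝓝[>] 0, 0 < p.2 :=
      tendsto_snd.eventually (eventually_mem_nhdsWithin)
    filter_upwards [this] with p hp
    exact ha.trans_le ((iInf_le _ p.1).trans ((iInf_le _ p.2).trans (iInf_le _ hp)))
  · simp only [iInf_lt_iff] at ha
    obtain ⟨m, δ, hδ, h⟩ := ha
    have h1 : ∀ᶠ p : ℕ × ℝ in atTop ×ˢ 𝓝[>] 0, m ≤ p.1 :=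
      tendsto_fst.eventually (eventually_ge_atTop m)
    have h2 : ∀ᶠ p : ℕ × ℝ in atTop ×ˢ 𝓝[>] 0, p.2 < δ :=
      tendsto_snd.eventually (eventually_nhdsWithin_of_eventually_nhds (eventually_lt_nhds hδ))
    filter_upwards [h1, h2] with p hp1 hp2
    exact (symRate_mono μ Ξ hp1 hp2.le).trans_lt h

/-- Approximating sequences exist. -/
theorem exists_isApproximating {R : ℝ} {n : ℕ} (ν : Fin n → Measure (Interval R))
    [∀ i, IsProbabilityMeasure (ν i)] :
    ∃ Ξ : (N : ℕ) → Fin n → Fin N → Interval R, IsApproximating ν Ξ := by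
  have key : ∀ i, ∃ ω : ℕ → Interval R, ∀ k : ℕ,
      Tendsto (fun N : ℕ => (N : ℝ)⁻¹ • ∑ j ∈ Finset.range N, (ω j : ℝ) ^ k) atTop
        (𝓝 (∫ x, (x : ℝ) ^ k ∂(ν i))) := by
    intro i
    let P : Measure (ℕ → Interval R) := Measure.infinitePi (fun _ => ν i)
    have hev : ∀ j : ℕ, P.map (fun ω => ω j) = ν i := fun j =>
      Measure.infinitePi_map_eval (fun _ : ℕ => ν i) j
    have hae : ∀ k : ℕ, ∀ᵐ ω ∂P,
        Tendsto (fun N : ℕ => (N : ℝ)⁻¹ • ∑ j ∈ Finset.range N, (ω j : ℝ) ^ k) atTop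
          (𝓝 (∫ x, (x : ℝ) ^ k ∂(ν i))) := by
      intro k
      have hg : Continuous (fun x : Interval R => (x : ℝ) ^ k) := by fun_prop
      have hind : ProbabilityTheory.iIndepFun
          (fun (j : ℕ) (ω : ℕ → Interval R) => (ω j : ℝ) ^ k) P :=
        ProbabilityTheory.iIndepFun_infinitePi (fun _ => hg.measurable)
      have hmeas : ∀ j : ℕ, Measurable (fun ω : ℕ → Interval R => ω j) := fun j =>
        measurable_pi_apply j
      have hint : ∫ x, (x : ℝ) ^ k ∂(ν i) = ∫ ω, ((ω 0 : Interval R) : ℝ) ^ k ∂P := by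
        rw [← hev 0, integral_map (hmeas 0).aemeasurable hg.aestronglyMeasurable]
      have hInt : Integrable (fun x : Interval R => (x : ℝ) ^ k) (ν i) :=
        hg.integrable_of_hasCompactSupport (HasCompactSupport.of_compactSpace _)
      rw [hint]
      refine ProbabilityTheory.strong_law_ae
        (fun (j : ℕ) (ω : ℕ → Interval R) => (ω j : ℝ) ^ k) ?_ ?_ ?_
      · rw [← hev 0] at hInt
        exact hInt.comp_measurable (hmeas 0)
      · exact fun a b hab => hind.indepFun hab
      · intro j
        have : ProbabilityTheory.IdentDistrib (fun ω : ℕ → Interval R => ω j)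
            (fun ω => ω 0) P P :=
          ⟨(hmeas j).aemeasurable, (hmeas 0).aemeasurable, by rw [hev, hev]⟩
        exact this.comp hg.measurable
    exact (ae_all_iff.2 hae).exists
  choose ω hω using key
  refine ⟨fun N i j => ω i (Tuple.sort (fun l : Fin N => ω i l) j), ⟨fun N i => ?_, fun i k => ?_⟩⟩
  · exact Tuple.monotone_sort (fun l : Fin N => ω i l)
  · refine (hω i k).congr fun N => ?_
    rw [kappa, one_div, smul_eq_mul,
      Equiv.sum_comp (Tuple.sort (fun l : Fin N => ω i l)) (fun l : Fin N => (ω i l : ℝ) ^ k),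
      ← Fin.sum_univ_eq_sum_range (fun j => (ω i j : ℝ) ^ k)]

end

end MutualPressure

open MeasureTheory Filter Topology

namespace MutualPressure

section DonskerVaradhan

variable {X : Type*} [MeasurableSpace X]

/-- The function `log (clip f)`, where `clip` truncates to `[exp (-M), exp M]`. -/
noncomputable def logClip (M x : ℝ) : ℝ := Real.log (max (Real.exp (-M)) (min x (Real.exp M)))

theorem exp_logClip (M x : ℝ) :
    Real.exp (logClip M x) = max (Real.exp (-M)) (min x (Real.exp M)) :=
  Real.exp_log (lt_max_of_lt_left (Real.exp_pos _))

theorem abs_logClip_le {M : ℝ} (hM : 0 ≤ M) (x : ℝ) : |logClip M x| ≤ M := by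
  have h := exp_logClip M x
  rw [abs_le]
  constructor
  · rw [← Real.exp_le_exp, h]; exact le_max_left _ _
  · rw [← Real.exp_le_exp, h]
    exact max_le (Real.exp_le_exp.2 (by linarith)) (min_le_right _ _)

theorem exp_logClip_le (M : ℝ) {x : ℝ} (hx : 0 ≤ x) :
    Real.exp (logClip M x) ≤ x + Real.exp (-M) := by
  rw [exp_logClip]
  exact max_le (by linarith) ((min_le_left _ _).trans (by linarith [Real.exp_pos (-M)]))

theorem measurable_logClip (M : ℝ) : Measurable (logClip M) := by
  unfold logClip; fun_prop

theorem mul_logClip_add_one_sub_nonneg {M : ℝ} (hM : 1 ≤ M) {x : ℝ} (hx : 0 ≤ x) :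
    0 ≤ x * logClip M x + 1 - x := by
  rcases le_total x (Real.exp (-M)) with h1 | h1
  · have h : logClip M x = -M := by
      rw [logClip, max_eq_left ((min_le_left _ _).trans h1), Real.log_exp]
    rw [h]
    have h2 : M + 1 ≤ Real.exp M := Real.add_one_le_exp M
    have h3 : x * (M + 1) ≤ Real.exp (-M) * Real.exp M := by gcongr
    rw [← Real.exp_add] at h3
    simp only [neg_add_cancel, Real.exp_zero] at h3
    linarith
  · rcases le_total x (Real.exp M) with h2 | h2
    · rw [logClip, min_eq_left h2, max_eq_right h1]
      exact InformationTheory.klFun_nonneg hx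
    · rw [logClip, min_eq_right h2, max_eq_right (Real.exp_le_exp.2 (by linarith)), Real.log_exp]
      nlinarith

theorem tendsto_mul_logClip {x : ℝ} (hx : 0 ≤ x) :
    Tendsto (fun M : ℕ => x * logClip (M + 1 : ℝ) x + 1 - x) atTop
      (𝓝 (InformationTheory.klFun x)) := by
  rcases hx.eq_or_lt with rfl | hx
  · simp [InformationTheory.klFun_zero]
  have h1 : ∀ᶠ M : ℕ in atTop, |Real.log x| ≤ M := by
    filter_upwards [tendsto_natCast_atTop_atTop.eventually_ge_atTop |Real.log x|] with M hM using hM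
  refine tendsto_const_nhds.congr' ?_
  filter_upwards [h1] with M hM
  rw [abs_le] at hM
  have ha : Real.exp (-(M + 1 : ℝ)) ≤ x := by
    rw [← Real.le_log_iff_exp_le hx]; linarith
  have hb : x ≤ Real.exp (M + 1 : ℝ) := by
    rw [← Real.log_le_iff_le_exp hx]; linarith
  rw [logClip, min_eq_left hb, max_eq_right ha, InformationTheory.klFun]

theorem abs_exp_sub_exp_le {M a b : ℝ} (ha : a ≤ M) (hb : b ≤ M) :
    |Real.exp a - Real.exp b| ≤ Real.exp M * |a - b| := by
  wlog h : a ≤ b generalizing a b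
  · rw [abs_sub_comm, abs_sub_comm a]; exact this hb ha (le_of_not_ge h)
  have h1 : a - b + 1 ≤ Real.exp (a - b) := Real.add_one_le_exp _
  have h2 : Real.exp a = Real.exp b * Real.exp (a - b) := by rw [← Real.exp_add]; ring_nf
  have h3 : Real.exp b ≤ Real.exp M := Real.exp_le_exp.2 hb
  rw [abs_sub_comm, abs_sub_comm a, abs_of_nonneg (sub_nonneg.2 (Real.exp_le_exp.2 h)),
    abs_of_nonneg (sub_nonneg.2 h), h2]
  nlinarith [Real.exp_pos b]

theorem integrable_of_abs_le {μ : Measure X} [IsFiniteMeasure μ] {f : X → ℝ} (hf : Measurable f)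
    {M : ℝ} (hM : ∀ x, |f x| ≤ M) : Integrable f μ :=
  Integrable.of_bound hf.aestronglyMeasurable M (ae_of_all _ hM)

theorem integrable_exp_of_abs_le {μ : Measure X} [IsFiniteMeasure μ] {f : X → ℝ}
    (hf : Measurable f) {M : ℝ} (hM : ∀ x, |f x| ≤ M) :
    Integrable (fun x => Real.exp (f x)) μ :=
  integrable_of_abs_le (M := Real.exp M) (by fun_prop) fun x => by
    rw [abs_of_pos (Real.exp_pos _)]; exact Real.exp_le_exp.2 ((le_abs_self _).trans (hM x))

variable {μ π : Measure X} [IsProbabilityMeasure μ] [IsProbabilityMeasure π]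

theorem klDiv_le_of_forall_bounded {C : ℝ}
    (h : ∀ (f : X → ℝ) (M : ℝ), Measurable f → (∀ x, |f x| ≤ M) →
      ∫ x, f x ∂μ - Real.log (∫ x, Real.exp (f x) ∂π) ≤ C) :
    InformationTheory.klDiv μ π ≤ ENNReal.ofReal C := by
  have hac : μ ≪ π := by
    refine Measure.AbsolutelyContinuous.mk fun s hs hs0 => ?_
    by_contra hne
    have hpos : 0 < μ.real s := by
      rw [measureReal_def]; exact ENNReal.toReal_pos hne (measure_ne_top _ _)
    obtain ⟨k, hk⟩ := exists_nat_gt (C / μ.real s)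
    rw [div_lt_iff₀ hpos] at hk
    have h1 := h (s.indicator fun _ => (k : ℝ)) k (measurable_const.indicator hs) fun x => by
      by_cases hx : x ∈ s <;> simp [hx]
    have h2 : ∫ x, Real.exp (s.indicator (fun _ => (k : ℝ)) x) ∂π = ∫ x, (1 : ℝ) ∂π := by
      refine integral_congr_ae ?_
      have : ∀ᵐ x ∂π, x ∉ s := by rw [ae_iff]; simpa using hs0
      filter_upwards [this] with x hx
      simp [hx]
    rw [h2, integral_indicator_const _ hs] at h1
    simp only [integral_const, probReal_univ, smul_eq_mul, mul_one, Real.log_one, sub_zero] at h1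
    linarith [mul_comm (k : ℝ) (μ.real s)]
  set f : X → ℝ := fun x => (μ.rnDeriv π x).toReal with hf
  have hfm : Measurable f := (Measure.measurable_rnDeriv μ π).ennreal_toReal
  have hf0 : ∀ x, 0 ≤ f x := fun x => ENNReal.toReal_nonneg
  have hfi : Integrable f π := Measure.integrable_toReal_rnDeriv
  have hf1 : ∫ x, f x ∂π = 1 := by
    have := Measure.integral_toReal_rnDeriv hac
    simpa using this
  let g : ℕ → X → ℝ := fun M x => f x * logClip (M + 1 : ℝ) (f x) + 1 - f x
  have hgm : ∀ M, Measurable (g M) := fun M => by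
    have := (measurable_logClip (M + 1 : ℝ)).comp hfm
    simp only [Function.comp_def] at this
    fun_prop
  have hclip : ∀ (M : ℕ) (x : X), |logClip (M + 1 : ℝ) (f x)| ≤ M + 1 := fun M x =>
    abs_logClip_le (by positivity) _
  have hg0 : ∀ M x, 0 ≤ g M x := fun M x =>
    mul_logClip_add_one_sub_nonneg (by linarith [Nat.cast_nonneg (α := ℝ) M]) (hf0 x)
  have hgi : ∀ M : ℕ, Integrable (fun x => f x * logClip (M + 1 : ℝ) (f x)) π := fun M => by
    refine hfi.mul_bdd (c := (M + 1 : ℝ)) ?_ (ae_of_all _ fun x => hclip M x)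
    exact ((measurable_logClip _).comp hfm).aestronglyMeasurable
  have hgint : ∀ M : ℕ, ∫ x, g M x ∂π ≤ C + Real.exp (-(M + 1 : ℝ)) := fun M => by
    have e1 : ∫ x, g M x ∂π = ∫ x, logClip (M + 1 : ℝ) (f x) ∂μ := by
      have : ∫ x, f x * logClip (M + 1 : ℝ) (f x) ∂π = ∫ x, logClip (M + 1 : ℝ) (f x) ∂μ :=
        integral_rnDeriv_smul hac (f := fun x => logClip (M + 1 : ℝ) (f x))
      calc ∫ x, g M x ∂π = ∫ x, (f x * logClip (M + 1 : ℝ) (f x) + (1 - f x)) ∂π := by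
            simp only [g, add_sub_assoc]
        _ = ∫ x, f x * logClip (M + 1 : ℝ) (f x) ∂π + (∫ _, (1 : ℝ) ∂π - ∫ x, f x ∂π) := by
            have hi : Integrable (fun x => 1 - f x) π := (integrable_const _).sub hfi
            rw [integral_add (hgi M) hi, integral_sub (integrable_const _) hfi]
        _ = _ := by rw [this, hf1]; simp
    have e2 := h (fun x => logClip (M + 1 : ℝ) (f x)) (M + 1) ((measurable_logClip _).comp hfm)
      (hclip M)
    have hei : Integrable (fun x => Real.exp (logClip (M + 1 : ℝ) (f x))) π :=
      integrable_exp_of_abs_le ((measurable_logClip _).comp hfm) (hclip M)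
    have e3 : ∫ x, Real.exp (logClip (M + 1 : ℝ) (f x)) ∂π ≤ 1 + Real.exp (-(M + 1 : ℝ)) := by
      calc _ ≤ ∫ x, (f x + Real.exp (-(M + 1 : ℝ))) ∂π :=
            integral_mono hei (hfi.add (integrable_const _)) fun x => exp_logClip_le _ (hf0 x)
        _ = _ := by rw [integral_add hfi (integrable_const _), hf1]; simp
    have e4 : 0 < ∫ x, Real.exp (logClip (M + 1 : ℝ) (f x)) ∂π := integral_exp_pos hei
    have e5 := Real.log_le_sub_one_of_pos e4
    rw [e1]; linarith
  rw [InformationTheory.klDiv_eq_lintegral_klFun_of_ac hac]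
  calc ∫⁻ x, ENNReal.ofReal (InformationTheory.klFun (f x)) ∂π
      = ∫⁻ x, liminf (fun M => ENNReal.ofReal (g M x)) atTop ∂π := by
        refine lintegral_congr fun x => ?_
        exact ((ENNReal.continuous_ofReal.tendsto _).comp
          (tendsto_mul_logClip (hf0 x))).liminf_eq.symm
    _ ≤ liminf (fun M => ∫⁻ x, ENNReal.ofReal (g M x) ∂π) atTop :=
        lintegral_liminf_le fun M => (hgm M).ennreal_ofReal
    _ ≤ liminf (fun M : ℕ => ENNReal.ofReal (C + Real.exp (-(M + 1 : ℝ)))) atTop := by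
        refine liminf_le_liminf (Eventually.of_forall fun M => ?_)
        have hi : Integrable (g M) π := ((hgi M).add (integrable_const _)).sub hfi
        rw [← ofReal_integral_eq_lintegral_ofReal hi (ae_of_all _ (hg0 M))]
        exact ENNReal.ofReal_le_ofReal (hgint M)
    _ = ENNReal.ofReal C := by
        refine Tendsto.liminf_eq ?_
        refine (ENNReal.continuous_ofReal.tendsto _).comp ?_
        have : Tendsto (fun M : ℕ => Real.exp (-(M + 1 : ℝ))) atTop (𝓝 0) :=
          Real.tendsto_exp_neg_atTop_nhds_zero.comp
            (tendsto_atTop_add_const_right _ _ tendsto_natCast_atTop_atTop)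
        simpa using this.const_add C

/-- The Donsker–Varadhan lower bound for the relative entropy by continuous test functions. -/
theorem klDiv_le_of_forall_continuous [TopologicalSpace X] [CompactSpace X]
    [TopologicalSpace.PseudoMetrizableSpace X] [BorelSpace X] {C : ℝ}
    (h : ∀ f : C(X, ℝ), ∫ x, f x ∂μ - Real.log (∫ x, Real.exp (f x) ∂π) ≤ C) :
    InformationTheory.klDiv μ π ≤ ENNReal.ofReal C := by
  refine klDiv_le_of_forall_bounded fun f M hf hM => ?_
  have hfi : Integrable f (μ + π) := integrable_of_abs_le hf hM
  have key : ∀ k : ℕ, ∫ x, f x ∂μ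
      - Real.log (∫ x, Real.exp (f x) ∂π + Real.exp M * (1 / ((k : ℝ) + 1))) ≤
        C + 1 / ((k : ℝ) + 1) := by
    intro k
    have hk : (0 : ℝ) < 1 / ((k : ℝ) + 1) := by positivity
    obtain ⟨g₀, hg₀, hg₀i⟩ := hfi.exists_boundedContinuous_integral_sub_le hk
    let g : C(X, ℝ) := ⟨fun x => max (-M) (min (g₀ x) M), by fun_prop⟩
    have hgM : ∀ x, |g x| ≤ M := fun x => by
      have : 0 ≤ M := (abs_nonneg _).trans (hM x)
      rw [abs_le]
      exact ⟨le_max_left _ _, max_le (by linarith) (min_le_right _ _)⟩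
    have hfg : ∀ x, |f x - g x| ≤ |f x - g₀ x| := fun x => by
      have h1 := abs_le.1 (hM x)
      have h2 : f x = max (-M) (min (f x) M) := by
        rw [min_eq_left h1.2, max_eq_right h1.1]
      have h3 : |max (-M) (min (f x) M) - max (-M) (min (g₀ x) M)| ≤
          |min (f x) M - min (g₀ x) M| := by
        have := abs_max_sub_max_le_max (-M) (min (f x) M) (-M) (min (g₀ x) M)
        simpa using this
      have h4 : |min (f x) M - min (g₀ x) M| ≤ |f x - g₀ x| := by
        have := abs_min_sub_min_le_max (f x) M (g₀ x) M
        simpa using this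
      calc |f x - g x| = |max (-M) (min (f x) M) - max (-M) (min (g₀ x) M)| := by
            rw [← h2]; rfl
        _ ≤ _ := h3.trans h4
    have hgm : Measurable g := g.continuous.measurable
    have hgi : Integrable g (μ + π) := integrable_of_abs_le hgm hgM
    have hd : Integrable (fun x => |f x - g x|) (μ + π) := (hfi.sub hgi).abs
    have hsum : ∫ x, |f x - g x| ∂μ + ∫ x, |f x - g x| ∂π ≤ 1 / ((k : ℝ) + 1) := by
      rw [← integral_add_measure hd.left_of_add_measure hd.right_of_add_measure]
      exact (integral_mono hd (hfi.sub hg₀i).abs hfg).trans hg₀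
    have hn1 : 0 ≤ ∫ x, |f x - g x| ∂μ := integral_nonneg fun x => abs_nonneg _
    have hn2 : 0 ≤ ∫ x, |f x - g x| ∂π := integral_nonneg fun x => abs_nonneg _
    have a1 : ∫ x, f x ∂μ ≤ ∫ x, g x ∂μ + 1 / ((k : ℝ) + 1) := by
      have : ∫ x, f x ∂μ - ∫ x, g x ∂μ ≤ ∫ x, |f x - g x| ∂μ := by
        rw [← integral_sub hfi.left_of_add_measure hgi.left_of_add_measure]
        exact integral_mono (hfi.sub hgi).left_of_add_measure hd.left_of_add_measure
          fun x => le_abs_self _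
      linarith
    have hef : Integrable (fun x => Real.exp (f x)) π := integrable_exp_of_abs_le hf hM
    have heg : Integrable (fun x => Real.exp (g x)) π := integrable_exp_of_abs_le hgm hgM
    have a2 : ∫ x, Real.exp (g x) ∂π ≤
        ∫ x, Real.exp (f x) ∂π + Real.exp M * (1 / ((k : ℝ) + 1)) := by
      have : ∫ x, Real.exp (g x) ∂π ≤ ∫ x, (Real.exp (f x) + Real.exp M * |f x - g x|) ∂π := by
        refine integral_mono heg (hef.add (hd.right_of_add_measure.const_mul _)) fun x => ?_
        have := abs_exp_sub_exp_le ((le_abs_self _).trans (hM x)) ((le_abs_self _).trans (hgM x))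
        have := neg_abs_le (Real.exp (f x) - Real.exp (g x))
        simp only
        linarith
      rw [integral_add hef (hd.right_of_add_measure.const_mul _), integral_const_mul] at this
      have : Real.exp M * ∫ x, |f x - g x| ∂π ≤ Real.exp M * (1 / ((k : ℝ) + 1)) := by
        gcongr; linarith
      linarith
    have a3 := h g
    have a4 := Real.log_le_log (integral_exp_pos heg) a2
    linarith
  have hpos : 0 < ∫ x, Real.exp (f x) ∂π :=
    integral_exp_pos (integrable_exp_of_abs_le hf hM)
  have t0 : Tendsto (fun k : ℕ => 1 / ((k : ℝ) + 1)) atTop (𝓝 0) :=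
    tendsto_one_div_add_atTop_nhds_zero_nat
  have t1 : Tendsto (fun k : ℕ => ∫ x, f x ∂μ
      - Real.log (∫ x, Real.exp (f x) ∂π + Real.exp M * (1 / ((k : ℝ) + 1)))) atTop
      (𝓝 (∫ x, f x ∂μ - Real.log (∫ x, Real.exp (f x) ∂π))) := by
    refine tendsto_const_nhds.sub (Tendsto.log ?_ hpos.ne')
    simpa using (t0.const_mul (Real.exp M)).const_add (∫ x, Real.exp (f x) ∂π)
  have t2 : Tendsto (fun k : ℕ => C + 1 / ((k : ℝ) + 1)) atTop (𝓝 C) := by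
    simpa using t0.const_add C
  exact le_of_tendsto_of_tendsto' t1 t2 key

end DonskerVaradhan

section ProductMeasure

theorem lintegral_fin_prod_eq_prod {n : ℕ} {X : Type*} [MeasurableSpace X]
    {μ : Fin n → Measure X} [∀ i, SigmaFinite (μ i)]
    {f : Fin n → X → ENNReal} (hf : ∀ i, Measurable (f i)) :
    ∫⁻ x : Fin n → X, ∏ i, f i (x i) ∂(Measure.pi μ) = ∏ i, ∫⁻ x, f i x ∂(μ i) := by
  induction n with
  | zero => simp
  | succ n ih =>
    have hm : ∀ i, Measurable fun x : Fin (n + 1) → X => f i (x i) := fun i =>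
      (hf i).comp (measurable_pi_apply i)
    have hm' : ∀ i, Measurable fun x : Fin n → X => f (Fin.succ i) (x i) := fun i =>
      (hf _).comp (measurable_pi_apply i)
    rw [← ((measurePreserving_piFinSuccAbove μ 0).symm).lintegral_comp
      (Finset.measurable_fun_prod _ fun i _ => hm i), Fin.prod_univ_succ,
      ← ih fun i => hf i.succ, ← lintegral_prod_mul (hf 0).aemeasurable
          (Finset.aemeasurable_fun_prod _ fun i _ => (hm' i).aemeasurable)]
    refine lintegral_congr fun x => ?_
    rw [Fin.prod_univ_succ]
    rfl

theorem pi_withDensity {n : ℕ} {X : Type*} [MeasurableSpace X]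
    {μ : Fin n → Measure X} [∀ i, SigmaFinite (μ i)]
    {f : Fin n → X → ENNReal} (hf : ∀ i, Measurable (f i))
    [∀ i, SigmaFinite ((μ i).withDensity (f i))] :
    Measure.pi (fun i => (μ i).withDensity (f i)) =
      (Measure.pi μ).withDensity fun x => ∏ i, f i (x i) := by
  refine Measure.pi_eq fun s hs => ?_
  rw [withDensity_apply _ (MeasurableSet.univ_pi hs), Measure.restrict_pi_pi,
    lintegral_fin_prod_eq_prod hf]
  exact Finset.prod_congr rfl fun i _ => (withDensity_apply _ (hs i)).symm

theorem pi_le_mul_pi_of_prod_exp_llr_le {N : ℕ} {X : Type*} [MeasurableSpace X]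
    {μ π : Measure X} [IsProbabilityMeasure μ] [IsProbabilityMeasure π] (hac : μ ≪ π)
    {E : Set (Fin N → X)} (hE : MeasurableSet E) {K : ENNReal}
    (hK : ∀ y ∈ E, ∏ j, ENNReal.ofReal (Real.exp (llr μ π (y j))) ≤ K) :
    Measure.pi (fun _ : Fin N => μ) E ≤ K * Measure.pi (fun _ : Fin N => π) E := by
  let f : X → ENNReal := fun x => ENNReal.ofReal (μ.rnDeriv π x).toReal
  have hf : Measurable f := (Measure.measurable_rnDeriv μ π).ennreal_toReal.ennreal_ofReal
  have hμ : π.withDensity f = μ := by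
    conv_rhs => rw [← Measure.withDensity_rnDeriv_eq μ π hac]
    refine withDensity_congr_ae ?_
    filter_upwards [Measure.rnDeriv_lt_top μ π] with x hx using ENNReal.ofReal_toReal hx.ne
  have : SigmaFinite (π.withDensity f) := by rw [hμ]; infer_instance
  have h := pi_withDensity (n := N) (μ := fun _ => π) (f := fun _ => f) fun _ => hf
  simp only [hμ] at h
  rw [h, withDensity_apply _ hE, ← setLIntegral_const]
  refine setLIntegral_mono measurable_const fun y hy => le_trans ?_ (hK y hy)
  exact Finset.prod_le_prod' fun j _ => ENNReal.ofReal_le_ofReal (Real.le_exp_log _)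

end ProductMeasure

section Shuffle

variable {ι κ X : Type*}

/-- The action of `S_ι^κ` on configurations `y : ι → κ → X`, permuting each column. -/
def shuffle (σ : κ → Equiv.Perm ι) (y : ι → κ → X) : ι → κ → X := fun j i => y ((σ i)⁻¹ j) i

theorem shuffle_shuffle (σ τ : κ → Equiv.Perm ι) (y : ι → κ → X) :
    shuffle σ (shuffle τ y) = shuffle (σ * τ) y := by
  ext j i; simp [shuffle]

theorem sum_shuffle_shuffle [Fintype ι] [Fintype κ] [DecidableEq ι] [DecidableEq κ]
    {M : Type*} [AddCommMonoid M] (F : (ι → κ → X) → M)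
    (τ : κ → Equiv.Perm ι) (y : ι → κ → X) :
    ∑ σ : κ → Equiv.Perm ι, F (shuffle σ (shuffle τ y)) =
      ∑ σ : κ → Equiv.Perm ι, F (shuffle σ y) := by
  simp_rw [shuffle_shuffle]
  exact Equiv.sum_comp (Equiv.mulRight τ) fun σ => F (shuffle σ y)

variable [MeasurableSpace X]

theorem measurable_shuffle (σ : κ → Equiv.Perm ι) :
    Measurable (shuffle σ : (ι → κ → X) → ι → κ → X) := by
  unfold shuffle; fun_prop

variable [Fintype ι] [Fintype κ] (ν : κ → Measure X) [∀ i, IsProbabilityMeasure (ν i)]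

theorem map_curry_pi :
    (Measure.pi fun p : ι × κ => ν p.2).map (MeasurableEquiv.curry ι κ X) =
      Measure.pi fun _ : ι => Measure.pi ν := by
  have := Measure.infinitePi_map_curry (fun (_ : ι) (i : κ) => ν i)
  simpa only [Measure.infinitePi_eq_pi] using this

theorem measurePreserving_shuffle (σ : κ → Equiv.Perm ι) :
    MeasurePreserving (shuffle σ) (Measure.pi fun _ : ι => Measure.pi ν)
      (Measure.pi fun _ : ι => Measure.pi ν) := by
  let e : ι × κ ≃ ι × κ :=
    { toFun := fun p => ((σ p.2)⁻¹ p.1, p.2)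
      invFun := fun p => (σ p.2 p.1, p.2)
      left_inv := fun p => by simp
      right_inv := fun p => by simp }
  have he : MeasurePreserving (fun (x : ι × κ → X) p => x (e p))
      (Measure.pi fun p : ι × κ => ν p.2) (Measure.pi fun p : ι × κ => ν p.2) := by
    refine ⟨by fun_prop, (Measure.pi_eq fun s hs => ?_).symm⟩
    rw [Measure.map_apply (by fun_prop) (MeasurableSet.univ_pi hs)]
    have : (fun (x : ι × κ → X) p => x (e p)) ⁻¹' Set.univ.pi s =
        Set.univ.pi fun p => s (e.symm p) := by
      ext x
      simp only [Set.mem_preimage, Set.mem_univ_pi]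
      exact ⟨fun h p => by simpa using h (e.symm p), fun h p => by simpa using h (e p)⟩
    rw [this, Measure.pi_pi, ← e.prod_comp]
    simp [e]
  refine ⟨measurable_shuffle σ, ?_⟩
  rw [← map_curry_pi, Measure.map_map (measurable_shuffle σ) (MeasurableEquiv.measurable _)]
  conv_rhs => rw [← he.map_eq]
  rw [Measure.map_map (MeasurableEquiv.measurable _) he.measurable]
  rfl

variable [DecidableEq ι] [DecidableEq κ]

theorem lintegral_sum_shuffle {F : (ι → κ → X) → ENNReal} (hF : Measurable F) :
    ∫⁻ y, ∑ σ : κ → Equiv.Perm ι, F (shuffle σ y) ∂(Measure.pi fun _ : ι => Measure.pi ν) =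
      Fintype.card (κ → Equiv.Perm ι) * ∫⁻ y, F y ∂(Measure.pi fun _ : ι => Measure.pi ν) := by
  have hm : ∀ σ : κ → Equiv.Perm ι, Measurable fun y => F (shuffle σ y) := fun σ =>
    hF.comp (measurable_shuffle σ)
  rw [lintegral_finsetSum _ fun σ _ => hm σ]
  simp_rw [(measurePreserving_shuffle ν _).lintegral_comp hF]
  simp

/-- Lower bound for an integral against a product measure by an average over permutations. -/
theorem sum_mul_measure_le_lintegral {F : (ι → κ → X) → ENNReal} (hF : Measurable F)
    {G : Set (ι → κ → X)} {c : (κ → Equiv.Perm ι) → ENNReal}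
    (h : ∀ y ∈ G, ∃ τ, ∀ σ, c σ ≤ F (shuffle σ (shuffle τ y))) :
    (∑ σ, c σ) * (Measure.pi fun _ : ι => Measure.pi ν) G ≤
      Fintype.card (κ → Equiv.Perm ι) * ∫⁻ y, F y ∂(Measure.pi fun _ : ι => Measure.pi ν) := by
  rw [← lintegral_sum_shuffle ν hF, ← setLIntegral_const]
  refine le_trans (setLIntegral_mono ?_ fun y hy => ?_) (setLIntegral_le_lintegral G _)
  · exact Finset.measurable_fun_sum _ fun σ _ => hF.comp (measurable_shuffle σ)
  · obtain ⟨τ, hτ⟩ := h y hy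
    rw [← sum_shuffle_shuffle F τ]
    exact Finset.sum_le_sum fun σ _ => hτ σ

/-- Upper bound for an integral against a product measure by an average over permutations. -/
theorem lintegral_le_sum {F : (ι → κ → X) → ENNReal} (hF : Measurable F)
    {c : (κ → Equiv.Perm ι) → ENNReal}
    (h : ∀ y, ∃ τ, ∀ σ, F (shuffle σ (shuffle τ y)) ≤ c σ) :
    Fintype.card (κ → Equiv.Perm ι) * ∫⁻ y, F y ∂(Measure.pi fun _ : ι => Measure.pi ν) ≤
      ∑ σ, c σ := by
  rw [← lintegral_sum_shuffle ν hF]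
  calc _ ≤ ∫⁻ _, ∑ σ, c σ ∂(Measure.pi fun _ : ι => Measure.pi ν) := by
        refine lintegral_mono fun y => ?_
        obtain ⟨τ, hτ⟩ := h y
        simp only
        rw [← sum_shuffle_shuffle F τ]
        exact Finset.sum_le_sum fun σ _ => hτ σ
    _ = _ := by simp

end Shuffle

section Kappa

variable {N : ℕ}

theorem kappa_mono {x y : Fin N → ℝ} (h : ∀ j, x j ≤ y j) : kappa x ≤ kappa y :=
  mul_le_mul_of_nonneg_left (Finset.sum_le_sum fun j _ => h j) (by positivity)

theorem kappa_add (x y : Fin N → ℝ) : kappa (fun j => x j + y j) = kappa x + kappa y := by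
  simp [kappa, Finset.sum_add_distrib, mul_add]

theorem kappa_sub (x y : Fin N → ℝ) : kappa (fun j => x j - y j) = kappa x - kappa y := by
  simp [kappa, Finset.sum_sub_distrib, mul_sub]

theorem kappa_const_mul (c : ℝ) (x : Fin N → ℝ) : kappa (fun j => c * x j) = c * kappa x := by
  simp only [kappa, ← Finset.mul_sum]; ring

theorem kappa_sum {ι : Type*} (s : Finset ι) (x : ι → Fin N → ℝ) :
    kappa (fun j => ∑ i ∈ s, x i j) = ∑ i ∈ s, kappa (x i) := by
  simp only [kappa, ← Finset.mul_sum]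
  rw [Finset.sum_comm]

theorem kappa_const_le {c : ℝ} (hc : 0 ≤ c) : kappa (fun _ : Fin N => c) ≤ c := by
  rcases Nat.eq_zero_or_pos N with rfl | hN
  · simpa [kappa] using hc
  · have : (N : ℝ) ≠ 0 := by positivity
    simp [kappa, this]

theorem kappa_const (hN : 0 < N) (c : ℝ) : kappa (fun _ : Fin N => c) = c := by
  have : (N : ℝ) ≠ 0 := by positivity
  simp [kappa, this]

theorem natCast_mul_kappa (x : Fin N → ℝ) : (N : ℝ) * kappa x = ∑ j, x j := by
  rcases Nat.eq_zero_or_pos N with rfl | hN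
  · simp [kappa]
  · have : (N : ℝ) ≠ 0 := by positivity
    rw [kappa, ← mul_assoc, mul_one_div_cancel this, one_mul]

theorem abs_kappa_le (x : Fin N → ℝ) : |kappa x| ≤ kappa fun j => |x j| := by
  rw [kappa, kappa, abs_mul, abs_of_nonneg (by positivity : (0 : ℝ) ≤ 1 / N)]
  exact mul_le_mul_of_nonneg_left (Finset.abs_sum_le_sum_abs _ _) (by positivity)

/-- The mean of a function along a finite sequence, as a linear functional. -/
noncomputable def kappaLinear {X : Type*} [TopologicalSpace X] (x : Fin N → X) : C(X, ℝ) →ₗ[ℝ] ℝ where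
  toFun f := kappa fun j => f (x j)
  map_add' _ _ := kappa_add _ _
  map_smul' c _ := kappa_const_mul c _

theorem abs_kappaLinear_le {X : Type*} [TopologicalSpace X] [CompactSpace X] (x : Fin N → X)
    (f : C(X, ℝ)) : |kappaLinear x f| ≤ ‖f‖ :=
  (abs_kappa_le _).trans ((kappa_mono fun j => f.norm_coe_le_norm (x j)).trans
    (kappa_const_le (norm_nonneg _)))

end Kappa

section StoneWeierstrass

variable {X : Type*} [TopologicalSpace X] [CompactSpace X]

theorem integrable_continuousMap [MeasurableSpace X] [BorelSpace X]
    (μ : Measure X) [IsFiniteMeasure μ] (f : C(X, ℝ)) : Integrable f μ :=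
  Integrable.of_bound f.continuous.measurable.aestronglyMeasurable ‖f‖
    (ae_of_all _ f.norm_coe_le_norm)

/-- Integration against a finite measure, as a linear functional on continuous functions. -/
noncomputable def integralLinear [MeasurableSpace X] [BorelSpace X]
    (μ : Measure X) [IsFiniteMeasure μ] : C(X, ℝ) →ₗ[ℝ] ℝ where
  toFun f := ∫ x, f x ∂μ
  map_add' f g := integral_add (integrable_continuousMap μ f) (integrable_continuousMap μ g)
  map_smul' c _ := integral_const_mul c _

theorem abs_integralLinear_le [MeasurableSpace X] [BorelSpace X]
    (μ : Measure X) [IsProbabilityMeasure μ] (f : C(X, ℝ)) : |integralLinear μ f| ≤ ‖f‖ := by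
  have := norm_integral_le_of_norm_le_const (μ := μ) (f := f) (C := ‖f‖)
    (ae_of_all _ f.norm_coe_le_norm)
  simpa [integralLinear] using this

/-- Convergence of contractive functionals on monomials implies convergence on all continuous
functions. -/
theorem tendsto_of_tendsto_monomials {ι : Type*} {l : Filter ι}
    {Λ : ι → C(X, ℝ) →ₗ[ℝ] ℝ} {Λ₀ : C(X, ℝ) →ₗ[ℝ] ℝ} (hΛ : ∀ a f, |Λ a f| ≤ ‖f‖)
    (hΛ₀ : ∀ f, |Λ₀ f| ≤ ‖f‖) {S : Set C(X, ℝ)}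
    (hsep : (Algebra.adjoin ℝ S).SeparatesPoints)
    (hS : ∀ f ∈ Submonoid.closure S, Tendsto (fun a => Λ a f) l (𝓝 (Λ₀ f))) (f : C(X, ℝ)) :
    Tendsto (fun a => Λ a f) l (𝓝 (Λ₀ f)) := by
  have hadj : ∀ g ∈ Algebra.adjoin ℝ S, Tendsto (fun a => Λ a g) l (𝓝 (Λ₀ g)) := by
    intro g hg
    rw [← Subalgebra.mem_toSubmodule, Algebra.adjoin_eq_span] at hg
    induction hg using Submodule.span_induction with
    | mem x hx => exact hS x hx
    | zero => simpa using tendsto_const_nhds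
    | add x y _ _ hx hy => simpa using hx.add hy
    | smul c x _ hx => simpa using hx.const_mul c
  have htop := ContinuousMap.subalgebra_topologicalClosure_eq_top_of_separatesPoints _ hsep
  have hf : f ∈ closure (Algebra.adjoin ℝ S : Set C(X, ℝ)) := by
    have : f ∈ (Algebra.adjoin ℝ S).topologicalClosure := by rw [htop]; trivial
    exact this
  rw [Metric.tendsto_nhds]
  intro ε hε
  obtain ⟨g, hg, hfg⟩ := Metric.mem_closure_iff.1 hf (ε / 3) (by positivity)
  rw [dist_eq_norm] at hfg
  filter_upwards [(Metric.tendsto_nhds.1 (hadj g hg)) (ε / 3) (by positivity)] with a ha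
  rw [Real.dist_eq] at ha ⊢
  have h1 := (hΛ a (f - g)).trans_lt hfg
  have h2 := (hΛ₀ (f - g)).trans_lt hfg
  rw [map_sub] at h1 h2
  rw [abs_lt] at *
  constructor <;> linarith [h1.1, h1.2, h2.1, h2.2, ha.1, ha.2]

end StoneWeierstrass

section Rearrangement

/-- A continuous cutoff equal to `1` on `(-∞, t]` and to `0` on `[t + δ, ∞)`. -/
noncomputable def cutoff (t δ x : ℝ) : ℝ := max 0 (min 1 ((t + δ - x) / δ))

theorem cutoff_nonneg (t δ x : ℝ) : 0 ≤ cutoff t δ x := le_max_left _ _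

theorem cutoff_le_one (t δ x : ℝ) : cutoff t δ x ≤ 1 := max_le zero_le_one (min_le_left _ _)

theorem cutoff_eq_one {t δ x : ℝ} (hδ : 0 < δ) (hx : x ≤ t) : cutoff t δ x = 1 := by
  have : 1 ≤ (t + δ - x) / δ := by rw [le_div_iff₀ hδ]; linarith
  rw [cutoff, min_eq_left this, max_eq_right zero_le_one]

theorem cutoff_eq_zero {t δ x : ℝ} (hδ : 0 < δ) (hx : t + δ ≤ x) : cutoff t δ x = 0 := by
  have : (t + δ - x) / δ ≤ 0 := div_nonpos_of_nonpos_of_nonneg (by linarith) hδ.le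
  rw [cutoff, max_eq_left ((min_le_right _ _).trans this)]

theorem continuous_cutoff (t δ : ℝ) : Continuous (cutoff t δ) := by
  unfold cutoff; fun_prop

open Classical in
theorem kappa_crossing_le {N : ℕ} {a b : Fin N → ℝ} (ha : Monotone a) (hb : Monotone b)
    (t : ℝ) {δ : ℝ} (hδ : 0 < δ) :
    kappa (fun j => if b j ≤ t ∧ t + δ < a j then (1 : ℝ) else 0) ≤
      |kappa (fun j => cutoff t δ (b j)) - kappa (fun j => cutoff t δ (a j))| := by
  by_cases hex : ∃ j, b j ≤ t ∧ t + δ < a j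
  · obtain ⟨j₀, hb₀, ha₀⟩ := hex
    refine le_trans ?_ (le_abs_self _)
    rw [← kappa_sub]
    refine kappa_mono fun j => ?_
    split_ifs with h
    · rw [cutoff_eq_one hδ h.1, cutoff_eq_zero hδ h.2.le]; simp
    · rw [sub_nonneg]
      rcases le_or_gt (a j) (t + δ) with h1 | h1
      · have : j ≤ j₀ := le_of_not_ge fun hj => absurd (ha hj) (by linarith)
        rw [cutoff_eq_one hδ ((hb this).trans hb₀)]
        exact cutoff_le_one _ _ _
      · rw [cutoff_eq_zero hδ h1.le]
        exact cutoff_nonneg _ _ _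
  · push Not at hex
    have : (fun j => if b j ≤ t ∧ t + δ < a j then (1 : ℝ) else 0) = fun _ => 0 := by
      ext j
      rw [if_neg]
      intro h
      exact absurd (hex j h.1) (not_le.2 h.2)
    rw [this]
    simp [kappa]

open Classical in
theorem sub_le_sum_crossing {R δ a b : ℝ} (hδ : 0 < δ) (ha : a ≤ R) (hb : -R ≤ b) :
    a - b ≤ 2 * δ + 2 * R * ∑ k ∈ Finset.range (⌈2 * R / δ⌉₊ + 1),
      (if b ≤ -R + k * δ ∧ -R + k * δ + δ < a then (1 : ℝ) else 0) := by
  have hnn : ∀ k : ℕ, (0 : ℝ) ≤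
      (if b ≤ -R + k * δ ∧ -R + k * δ + δ < a then (1 : ℝ) else 0) := fun k => by
    split_ifs <;> norm_num
  rcases le_or_gt (a - b) (2 * δ) with h | h
  · by_cases h' : 0 ≤ 2 * R
    · have := mul_nonneg h' (Finset.sum_nonneg fun k (_ : k ∈ Finset.range (⌈2 * R / δ⌉₊ + 1)) =>
        hnn k)
      linarith
    · rw [Finset.sum_eq_zero]
      · linarith
      · intro k _
        rw [if_neg]
        rintro ⟨h1, h2⟩
        have : 0 ≤ (k : ℝ) * δ := by positivity
        linarith
  · let k := ⌈(b + R) / δ⌉₊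
    have hk1 : (b + R) / δ ≤ k := Nat.le_ceil _
    have hk2 : (k : ℝ) < (b + R) / δ + 1 := Nat.ceil_lt_add_one (div_nonneg (by linarith) hδ.le)
    rw [div_le_iff₀ hδ] at hk1
    have hk2' : (k : ℝ) * δ < b + R + δ := by
      have := mul_lt_mul_of_pos_right hk2 hδ
      rwa [add_mul, div_mul_cancel₀ _ hδ.ne', one_mul] at this
    have hmem : k ∈ Finset.range (⌈2 * R / δ⌉₊ + 1) := by
      rw [Finset.mem_range, Nat.lt_succ_iff]
      refine Nat.ceil_mono ?_
      gcongr
      linarith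
    have h1 : (1 : ℝ) ≤ ∑ k ∈ Finset.range (⌈2 * R / δ⌉₊ + 1),
        (if b ≤ -R + k * δ ∧ -R + k * δ + δ < a then (1 : ℝ) else 0) := by
      refine le_trans ?_ (Finset.single_le_sum (fun k _ => hnn k) hmem)
      rw [if_pos ⟨by linarith, by linarith⟩]
    have h2 : 2 * R * 1 ≤ 2 * R * ∑ k ∈ Finset.range (⌈2 * R / δ⌉₊ + 1),
        (if b ≤ -R + k * δ ∧ -R + k * δ + δ < a then (1 : ℝ) else 0) :=
      mul_le_mul_of_nonneg_left h1 (by linarith)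
    linarith

/-- Increasing sequences whose empirical distributions have the same limit are close in mean. -/
theorem tendsto_kappa_abs_sub {R : ℝ} {a b : (N : ℕ) → Fin N → Interval R}
    (ha : ∀ N, Monotone (a N)) (hb : ∀ N, Monotone (b N)) {ℓ : C(Interval R, ℝ) → ℝ}
    (hta : ∀ f : C(Interval R, ℝ), Tendsto (fun N => kappa fun j => f (a N j)) atTop (𝓝 (ℓ f)))
    (htb : ∀ f : C(Interval R, ℝ), Tendsto (fun N => kappa fun j => f (b N j)) atTop (𝓝 (ℓ f))) :
    Tendsto (fun N => kappa fun j => |(a N j : ℝ) - b N j|) atTop (𝓝 0) := by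
  classical
  have hnn : ∀ N, 0 ≤ kappa fun j => |(a N j : ℝ) - b N j| := fun N => by
    have : kappa (fun _ : Fin N => (0 : ℝ)) ≤ kappa fun j => |(a N j : ℝ) - b N j| :=
      kappa_mono fun j => abs_nonneg _
    simpa [kappa] using this
  rw [Metric.tendsto_nhds]
  intro ε hε
  set δ := ε / 4 with hδdef
  have hδ : 0 < δ := by positivity
  set K := ⌈2 * R / δ⌉₊ + 1 with hK
  let ψ : ℕ → C(Interval R, ℝ) := fun k =>
    ⟨fun x => cutoff (-R + k * δ) δ x, (continuous_cutoff _ _).comp continuous_subtype_val⟩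
  have hlim : Tendsto (fun N => 2 * R * ∑ k ∈ Finset.range K,
      (2 * |kappa (fun j => ψ k (b N j)) - kappa (fun j => ψ k (a N j))|)) atTop (𝓝 0) := by
    have : Tendsto (fun N => 2 * R * ∑ k ∈ Finset.range K,
        (2 * |kappa (fun j => ψ k (b N j)) - kappa (fun j => ψ k (a N j))|)) atTop
        (𝓝 (2 * R * ∑ k ∈ Finset.range K, (2 * |ℓ (ψ k) - ℓ (ψ k)|))) :=
      (tendsto_finsetSum _ fun k _ => ((htb (ψ k)).sub (hta (ψ k))).abs.const_mul 2).const_mul _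
    simpa using this
  filter_upwards [(Metric.tendsto_nhds.1 hlim) (ε / 2) (by positivity),
    eventually_gt_atTop 0] with N hN hN0
  rw [Real.dist_eq, sub_zero] at hN ⊢
  rw [abs_of_nonneg (hnn N)]
  have hR : 0 ≤ 2 * R := by
    have h := (a N ⟨0, hN0⟩).2
    linarith [h.1, h.2]
  have hamono : Monotone fun j => (a N j : ℝ) := fun i j h => ha N h
  have hbmono : Monotone fun j => (b N j : ℝ) := fun i j h => hb N h
  let c1 : ℕ → Fin N → ℝ := fun k j =>
    if (b N j : ℝ) ≤ -R + k * δ ∧ -R + k * δ + δ < a N j then (1 : ℝ) else 0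
  let c2 : ℕ → Fin N → ℝ := fun k j =>
    if (a N j : ℝ) ≤ -R + k * δ ∧ -R + k * δ + δ < b N j then (1 : ℝ) else 0
  have c1nn : ∀ j, 0 ≤ ∑ k ∈ Finset.range K, c1 k j := fun j =>
    Finset.sum_nonneg fun k _ => by simp only [c1]; split_ifs <;> norm_num
  have c2nn : ∀ j, 0 ≤ ∑ k ∈ Finset.range K, c2 k j := fun j =>
    Finset.sum_nonneg fun k _ => by simp only [c2]; split_ifs <;> norm_num
  have hpt : ∀ j, |(a N j : ℝ) - b N j| ≤
      2 * δ + 2 * R * ∑ k ∈ Finset.range K, (c1 k j + c2 k j) := by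
    intro j
    have h1 := sub_le_sum_crossing hδ (a N j).2.2 (b N j).2.1
    have h2 := sub_le_sum_crossing hδ (b N j).2.2 (a N j).2.1
    have e1 := mul_nonneg hR (c1nn j)
    have e2 := mul_nonneg hR (c2nn j)
    rw [Finset.sum_add_distrib, mul_add, abs_le]
    constructor
    · linarith
    · linarith
  have hsum : kappa (fun j => |(a N j : ℝ) - b N j|) ≤ 2 * δ + 2 * R * ∑ k ∈ Finset.range K,
      (2 * |kappa (fun j => ψ k (b N j)) - kappa (fun j => ψ k (a N j))|) := by
    refine (kappa_mono hpt).trans ?_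
    rw [kappa_add, kappa_const_mul (2 * R), kappa_sum, kappa_const hN0]
    gcongr with k hk
    rw [kappa_add, two_mul]
    refine add_le_add (kappa_crossing_le hamono hbmono _ hδ) ?_
    rw [abs_sub_comm]
    exact kappa_crossing_le hbmono hamono _ hδ
  have := le_abs_self (2 * R * ∑ k ∈ Finset.range K,
      (2 * |kappa (fun j => ψ k (b N j)) - kappa (fun j => ψ k (a N j))|))
  linarith

end Rearrangement

section Approximating

variable {R : ℝ} {n : ℕ}

/-- The inclusion `[-R, R] → ℝ` as a continuous function. -/
def coordinate (R : ℝ) : C(Interval R, ℝ) := ⟨Subtype.val, continuous_subtype_val⟩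

theorem tendsto_kappa_of_tendsto_moment {ν : Measure (Interval R)} [IsProbabilityMeasure ν]
    {a : (N : ℕ) → Fin N → Interval R}
    (h : ∀ k : ℕ, Tendsto (fun N => kappa fun j => (a N j : ℝ) ^ k) atTop
      (𝓝 (∫ x, (x : ℝ) ^ k ∂ν))) (f : C(Interval R, ℝ)) :
    Tendsto (fun N => kappa fun j => f (a N j)) atTop (𝓝 (∫ x, f x ∂ν)) := by
  refine tendsto_of_tendsto_monomials (Λ := fun N => kappaLinear (a N)) (Λ₀ := integralLinear ν)
    (fun N f => abs_kappaLinear_le _ f) (abs_integralLinear_le ν) (S := {coordinate R}) ?_ ?_ f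
  · intro x y hxy
    refine ⟨coordinate R, ⟨coordinate R, Algebra.subset_adjoin rfl, rfl⟩, ?_⟩
    exact fun h => hxy (Subtype.ext h)
  · intro g hg
    obtain ⟨k, rfl⟩ := Submonoid.mem_closure_singleton.1 hg
    exact h k

theorem IsApproximating.tendsto_kappa {ν : Fin n → Measure (Interval R)}
    [∀ i, IsProbabilityMeasure (ν i)] {Ξ : (N : ℕ) → Fin n → Fin N → Interval R}
    (hΞ : IsApproximating ν Ξ) (i : Fin n) (f : C(Interval R, ℝ)) :
    Tendsto (fun N => kappa fun j => f (Ξ N i j)) atTop (𝓝 (∫ x, f x ∂ν i)) :=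
  tendsto_kappa_of_tendsto_moment (hΞ.tendsto_moment i) f

theorem exists_abs_sub_le_add_mul (h : C(Box R n, ℝ)) {ε : ℝ} (hε : 0 < ε) :
    ∃ K : ℝ, 0 ≤ K ∧ ∀ x y : Box R n, |h x - h y| ≤ ε + K * ∑ i, |(x i : ℝ) - y i| := by
  have hu : UniformContinuous h := CompactSpace.uniformContinuous_of_continuous h.continuous
  obtain ⟨δ, hδ, H⟩ := Metric.uniformContinuous_iff.1 hu ε hε
  refine ⟨2 * ‖h‖ / δ, by positivity, fun x y => ?_⟩
  have hs : 0 ≤ ∑ i, |(x i : ℝ) - y i| := Finset.sum_nonneg fun i _ => abs_nonneg _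
  rcases lt_or_ge (∑ i, |(x i : ℝ) - y i|) δ with hlt | hge
  · have hd : dist x y < δ := by
      refine lt_of_le_of_lt ((dist_pi_le_iff hs).2 fun i => ?_) hlt
      exact Finset.single_le_sum (f := fun i => |(x i : ℝ) - y i|) (fun i _ => abs_nonneg _)
        (Finset.mem_univ i)
    have := H hd
    rw [Real.dist_eq] at this
    have : 0 ≤ 2 * ‖h‖ / δ * ∑ i, |(x i : ℝ) - y i| := by positivity
    linarith
  · have h1 : |h x - h y| ≤ 2 * ‖h‖ := by
      have := abs_sub (h x) (h y)
      have a1 := h.norm_coe_le_norm x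
      have a2 := h.norm_coe_le_norm y
      rw [Real.norm_eq_abs] at a1 a2
      linarith
    have h2 : 2 * ‖h‖ / δ * δ ≤ 2 * ‖h‖ / δ * ∑ i, |(x i : ℝ) - y i| := by gcongr
    rw [div_mul_cancel₀ _ hδ.ne'] at h2
    linarith

/-- Configurations that are close in mean have close averages of a continuous function. -/
theorem exists_abs_kappa_sub_le (h : C(Box R n, ℝ)) {ε : ℝ} (hε : 0 < ε) :
    ∃ η : ℝ, 0 < η ∧ ∀ (N : ℕ) (x y : Fin N → Box R n),
      kappa (fun j => ∑ i, |(x j i : ℝ) - y j i|) < η →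
        |kappa (fun j => h (x j)) - kappa (fun j => h (y j))| ≤ ε := by
  obtain ⟨K, hK, H⟩ := exists_abs_sub_le_add_mul h (half_pos hε)
  refine ⟨ε / (2 * (K + 1)), by positivity, fun N x y hxy => ?_⟩
  rw [← kappa_sub]
  refine (abs_kappa_le _).trans ((kappa_mono fun j => H (x j) (y j)).trans ?_)
  rw [kappa_add, kappa_const_mul]
  have h1 := kappa_const_le (N := N) (half_pos hε).le
  have h2 : K * kappa (fun j => ∑ i, |(x j i : ℝ) - y j i|) ≤ K * (ε / (2 * (K + 1))) := by
    gcongr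
  have h3 : K * (ε / (2 * (K + 1))) ≤ ε / 2 := by
    rw [← mul_div_assoc, div_le_div_iff₀ (by positivity) (by positivity)]
    nlinarith
  linarith

end Approximating

section LawOfLargeNumbers

variable {X : Type*} [MeasurableSpace X] (μ : Measure X) [IsProbabilityMeasure μ]

theorem map_infinitePi_initial (N : ℕ) :
    (Measure.infinitePi fun _ : ℕ => μ).map (fun ω (j : Fin N) => ω j) =
      Measure.pi fun _ : Fin N => μ := by
  have h := ProbabilityTheory.iIndepFun_infinitePi (P := fun _ : ℕ => μ)
    (X := fun _ => (id : X → X)) fun _ => measurable_id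
  have h2 := (h.precomp (Fin.val_injective (n := N))).map_fun_eq_pi_map
    fun i : Fin N => (measurable_id.comp (measurable_pi_apply (i : ℕ))).aemeasurable
  refine h2.trans ?_
  congr 1
  ext1 j
  exact Measure.infinitePi_map_eval (fun _ : ℕ => μ) (j : ℕ)

theorem tendsto_pi_of_ae_eventually_mem {A : (N : ℕ) → Set (Fin N → X)}
    (hA : ∀ N, MeasurableSet (A N))
    (h : ∀ᵐ ω ∂(Measure.infinitePi fun _ : ℕ => μ), ∀ᶠ N in atTop,
      (fun j : Fin N => ω j) ∈ A N) :
    Tendsto (fun N => Measure.pi (fun _ : Fin N => μ) (A N)) atTop (𝓝 1) := by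
  have hm : ∀ N : ℕ, Measurable fun (ω : ℕ → X) (j : Fin N) => ω j := fun N => by fun_prop
  have := tendsto_measure_of_ae_tendsto_indicator_of_isFiniteMeasure atTop
    (μ := Measure.infinitePi fun _ : ℕ => μ) (A := Set.univ)
    (As := fun N => (fun (ω : ℕ → X) (j : Fin N) => ω j) ⁻¹' A N) MeasurableSet.univ
    (fun N => hm N (hA N)) (by
      filter_upwards [h] with ω hω
      filter_upwards [hω] with N hN
      simpa using hN)
  rw [measure_univ] at this
  refine this.congr fun N => ?_
  rw [← map_infinitePi_initial, Measure.map_apply (hm N) (hA N)]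

theorem ae_tendsto_kappa {f : X → ℝ} (hf : Measurable f) (hi : Integrable f μ) :
    ∀ᵐ ω ∂(Measure.infinitePi fun _ : ℕ => μ),
      Tendsto (fun N : ℕ => kappa fun j : Fin N => f (ω j)) atTop (𝓝 (∫ x, f x ∂μ)) := by
  let P : Measure (ℕ → X) := Measure.infinitePi fun _ => μ
  have hev : ∀ j : ℕ, P.map (fun ω => ω j) = μ := fun j =>
    Measure.infinitePi_map_eval (fun _ : ℕ => μ) j
  have hmeas : ∀ j : ℕ, Measurable (fun ω : ℕ → X => ω j) := fun j => measurable_pi_apply j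
  have hind : ProbabilityTheory.iIndepFun (fun (j : ℕ) (ω : ℕ → X) => f (ω j)) P :=
    ProbabilityTheory.iIndepFun_infinitePi fun _ => hf
  have hint : ∫ x, f x ∂μ = ∫ ω, f (ω 0) ∂P := by
    conv_lhs => rw [← hev 0]
    rw [integral_map (hmeas 0).aemeasurable hf.aestronglyMeasurable]
  have hInt : Integrable (fun ω : ℕ → X => f (ω 0)) P := by
    rw [← hev 0] at hi
    exact hi.comp_measurable (hmeas 0)
  have := ProbabilityTheory.strong_law_ae (fun (j : ℕ) (ω : ℕ → X) => f (ω j)) hInt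
    (fun a b hab => hind.indepFun hab) fun j => by
      have : ProbabilityTheory.IdentDistrib (fun ω : ℕ → X => ω j) (fun ω => ω 0) P P :=
        ⟨(hmeas j).aemeasurable, (hmeas 0).aemeasurable, by rw [hev, hev]⟩
      exact this.comp hf
  rw [hint]
  filter_upwards [this] with ω hω
  refine hω.congr fun N => ?_
  rw [kappa, one_div, smul_eq_mul, ← Fin.sum_univ_eq_sum_range (fun j => f (ω j))]

end LawOfLargeNumbers

section Configurations

variable {R : ℝ} {n : ℕ}

/-- Configurations which, after permuting their columns, are `η`-close in mean to `ξ`. -/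
def nearShuffles {N : ℕ} (ξ : Fin n → Fin N → Interval R) (η : ℝ) : Set (Fin N → Box R n) :=
  {y | ∃ τ : Fin n → Equiv.Perm (Fin N),
    kappa (fun j => ∑ i, |((shuffle τ y j i : Interval R) : ℝ) - ξ i j|) < η}

theorem measurableSet_nearShuffles {N : ℕ} (ξ : Fin n → Fin N → Interval R) (η : ℝ) :
    MeasurableSet (nearShuffles ξ η) := by
  have : nearShuffles ξ η = ⋃ τ : Fin n → Equiv.Perm (Fin N),
      {y | kappa (fun j => ∑ i, |((shuffle τ y j i : Interval R) : ℝ) - ξ i j|) < η} := by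
    ext y; simp [nearShuffles]
  rw [this]
  refine MeasurableSet.iUnion fun τ => measurableSet_lt ?_ measurable_const
  unfold kappa shuffle
  fun_prop

theorem shuffle_mem_nearShuffles {N : ℕ} {ξ : Fin n → Fin N → Interval R} {η : ℝ}
    {σ : Fin n → Equiv.Perm (Fin N)} {y : Fin N → Box R n}
    (h : shuffle σ y ∈ nearShuffles ξ η) : y ∈ nearShuffles ξ η := by
  obtain ⟨τ, hτ⟩ := h
  rw [shuffle_shuffle] at hτ
  exact ⟨τ * σ, hτ⟩

theorem kappa_shuffle_sub {N : ℕ} (σ : Fin n → Equiv.Perm (Fin N)) (x y : Fin N → Box R n) :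
    kappa (fun j => ∑ i, |((shuffle σ x j i : Interval R) : ℝ) - (shuffle σ y j i : Interval R)|) =
      kappa (fun j => ∑ i, |(x j i : ℝ) - y j i|) := by
  rw [kappa_sum, kappa_sum]
  refine Finset.sum_congr rfl fun i _ => ?_
  unfold kappa
  congr 1
  exact Equiv.sum_comp (σ i)⁻¹ fun j => |(x j i : ℝ) - y j i|

theorem ae_eventually_mem_nearShuffles {ρ : Measure (Box R n)} [IsProbabilityMeasure ρ]
    {Ξ : (N : ℕ) → Fin n → Fin N → Interval R} (hΞ : IsApproximating (marginal ρ) Ξ)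
    {η : ℝ} (hη : 0 < η) :
    ∀ᵐ ω ∂(Measure.infinitePi fun _ : ℕ => ρ), ∀ᶠ N in atTop,
      (fun j : Fin N => ω j) ∈ nearShuffles (Ξ N) η := by
  have hprob : ∀ i, IsProbabilityMeasure (marginal ρ i) := fun i =>
    Measure.isProbabilityMeasure_map (measurable_pi_apply i).aemeasurable
  have hmom : ∀ᵐ ω ∂(Measure.infinitePi fun _ : ℕ => ρ), ∀ (i : Fin n) (k : ℕ),
      Tendsto (fun N : ℕ => kappa fun j : Fin N => (ω j i : ℝ) ^ k) atTop
        (𝓝 (∫ x, (x : ℝ) ^ k ∂marginal ρ i)) := by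
    refine ae_all_iff.2 fun i => ae_all_iff.2 fun k => ?_
    let f : C(Box R n, ℝ) := ⟨fun x => (x i : ℝ) ^ k, by fun_prop⟩
    have hint : ∫ x, (x : ℝ) ^ k ∂marginal ρ i = ∫ x, f x ∂ρ := by
      rw [marginal, integral_map (measurable_pi_apply i).aemeasurable
        (by fun_prop : Continuous fun x : Interval R => (x : ℝ) ^ k).aestronglyMeasurable]
      rfl
    rw [hint]
    exact ae_tendsto_kappa ρ f.continuous.measurable (integrable_continuousMap ρ f)
  filter_upwards [hmom] with ω hω
  let s : (N : ℕ) → Fin n → Equiv.Perm (Fin N) := fun N i => Tuple.sort fun l : Fin N => ω l i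
  have hsort : ∀ i, Tendsto (fun N => kappa fun j =>
      |(ω (s N i j) i : ℝ) - Ξ N i j|) atTop (𝓝 0) := by
    intro i
    refine tendsto_kappa_abs_sub (a := fun N j => ω (s N i j) i) (b := fun N j => Ξ N i j)
      (fun N => Tuple.monotone_sort fun l : Fin N => ω l i) (fun N => hΞ.monotone N i)
      (ℓ := fun f => ∫ x, f x ∂marginal ρ i)
      (tendsto_kappa_of_tendsto_moment fun k => ?_) (hΞ.tendsto_kappa i)
    refine (hω i k).congr fun N => ?_
    unfold kappa
    rw [Equiv.sum_comp (s N i) fun l : Fin N => (ω l i : ℝ) ^ k]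
  have hsum : Tendsto (fun N => kappa fun j => ∑ i, |(ω (s N i j) i : ℝ) - Ξ N i j|) atTop
      (𝓝 0) := by
    simp_rw [kappa_sum]
    simpa using tendsto_finsetSum Finset.univ fun i _ => hsort i
  filter_upwards [hsum.eventually_lt_const hη] with N hN
  exact ⟨fun i => (s N i)⁻¹, by simpa [shuffle] using hN⟩

/-- The monomial `x ↦ x_{i_1} ⋯ x_{i_k}` on the box. -/
def monomial {k : ℕ} (i : Fin k → Fin n) : C(Box R n, ℝ) :=
  ⟨fun x => ∏ l, (x (i l) : ℝ), by fun_prop⟩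

theorem mem_microstates_iff {μ : Measure (Box R n)} {N m : ℕ} {δ : ℝ}
    {x : Fin n → Fin N → Interval R} :
    x ∈ microstates μ N m δ ↔ ∀ k : ℕ, 1 ≤ k → k ≤ m → ∀ i : Fin k → Fin n,
      |kappa (fun j => (monomial i : C(Box R n, ℝ)) fun i => x i j)
        - ∫ y, (monomial i : C(Box R n, ℝ)) y ∂μ| < δ := Iff.rfl

theorem measurableSet_microstates (μ : Measure (Box R n)) (N m : ℕ) (δ : ℝ) :
    MeasurableSet {y : Fin N → Box R n | (fun i j => y j i) ∈ microstates μ N m δ} := by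
  have : {y : Fin N → Box R n | (fun i j => y j i) ∈ microstates μ N m δ} =
      ⋂ (k : ℕ) (_ : 1 ≤ k) (_ : k ≤ m) (i : Fin k → Fin n), {y : Fin N → Box R n |
        |kappa (fun j => ∏ l, (y j (i l) : ℝ)) - ∫ y, ∏ l, (y (i l) : ℝ) ∂μ| < δ} := by
    ext y; simp [microstates]
  rw [this]
  refine MeasurableSet.iInter fun k => MeasurableSet.iInter fun _ => MeasurableSet.iInter fun _ =>
    MeasurableSet.iInter fun i => measurableSet_lt ?_ measurable_const
  unfold kappa
  fun_prop

theorem ae_eventually_mem_microstates (μ : Measure (Box R n)) [IsProbabilityMeasure μ]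
    (m : ℕ) {δ : ℝ} (hδ : 0 < δ) :
    ∀ᵐ ω ∂(Measure.infinitePi fun _ : ℕ => μ), ∀ᶠ N in atTop,
      (fun (i : Fin n) (j : Fin N) => ω j i) ∈ microstates μ N m δ := by
  have h : ∀ᵐ ω ∂(Measure.infinitePi fun _ : ℕ => μ), ∀ (k : ℕ) (i : Fin k → Fin n),
      Tendsto (fun N : ℕ => kappa fun j : Fin N => (monomial i : C(Box R n, ℝ)) (ω j)) atTop
        (𝓝 (∫ x, (monomial i : C(Box R n, ℝ)) x ∂μ)) :=
    ae_all_iff.2 fun k => ae_all_iff.2 fun i =>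
      ae_tendsto_kappa μ (monomial i).continuous.measurable (integrable_continuousMap μ _)
  filter_upwards [h] with ω hω
  have h1 : ∀ᶠ N : ℕ in atTop, ∀ k ∈ Finset.Icc 1 m, ∀ i : Fin k → Fin n,
      |kappa (fun j : Fin N => (monomial i : C(Box R n, ℝ)) (ω j))
        - ∫ y, (monomial i : C(Box R n, ℝ)) y ∂μ| < δ := by
    rw [Filter.eventually_all_finset]
    intro k _
    rw [Filter.eventually_all]
    intro i
    exact (Metric.tendsto_nhds.1 (hω k i)) δ hδ
  filter_upwards [h1] with N hN k hk hkm i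
  exact hN k (Finset.mem_Icc.2 ⟨hk, hkm⟩) i

theorem exists_eq_monomial_of_mem_closure {f : C(Box R n, ℝ)}
    (hf : f ∈ Submonoid.closure (Set.range fun a : Fin n =>
      (⟨fun x => (x a : ℝ), by fun_prop⟩ : C(Box R n, ℝ)))) :
    ∃ (k : ℕ) (i : Fin k → Fin n), f = monomial i := by
  induction hf using Submonoid.closure_induction with
  | mem x hx =>
    obtain ⟨a, rfl⟩ := hx
    exact ⟨1, fun _ => a, by ext x; simp [monomial]⟩
  | one => exact ⟨0, Fin.elim0, by ext x; simp [monomial]⟩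
  | mul x y _ _ hx hy =>
    obtain ⟨k, i, rfl⟩ := hx
    obtain ⟨k', i', rfl⟩ := hy
    exact ⟨k + k', Fin.append i i', by ext x; simp [monomial, Fin.prod_univ_add]⟩

/-- On microstates of high precision, the average of a continuous function is close to its
integral. -/
theorem exists_microstates_kappa_close (μ : Measure (Box R n)) [IsProbabilityMeasure μ]
    (h : C(Box R n, ℝ)) {ε : ℝ} (hε : 0 < ε) :
    ∃ (m : ℕ) (δ : ℝ), 0 < δ ∧ ∀ N : ℕ, 0 < N → ∀ x ∈ microstates μ N m δ,
      |kappa (fun j => h fun i => x i j) - ∫ y, h y ∂μ| ≤ ε := by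
  by_contra! hcon
  choose N hN x hx hbad using fun k : ℕ => hcon k (1 / ((k : ℝ) + 1)) (by positivity)
  have hlim : Tendsto (fun k => kappa fun j => h fun i => x k i j) atTop
      (𝓝 (∫ y, h y ∂μ)) := by
    refine tendsto_of_tendsto_monomials (Λ := fun k => kappaLinear fun j i => x k i j)
      (Λ₀ := integralLinear μ) (fun k f => abs_kappaLinear_le _ f) (abs_integralLinear_le μ)
      (S := Set.range fun a : Fin n =>
        (⟨fun x => (x a : ℝ), by fun_prop⟩ : C(Box R n, ℝ))) ?_ ?_ h
    · intro y z hyz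
      obtain ⟨a, ha⟩ := Function.ne_iff.1 hyz
      refine ⟨_, ⟨_, Algebra.subset_adjoin ⟨a, rfl⟩, rfl⟩, ?_⟩
      exact fun h => ha (Subtype.ext h)
    · intro f hf
      obtain ⟨q, i, rfl⟩ := exists_eq_monomial_of_mem_closure hf
      rcases Nat.eq_zero_or_pos q with rfl | hq
      · have h1 : ∀ k, kappaLinear (fun j i => x k i j) (monomial i : C(Box R n, ℝ)) = 1 :=
          fun k => by simp [kappaLinear, monomial, kappa_const (hN k)]
        have h2 : integralLinear μ (monomial i : C(Box R n, ℝ)) = 1 := by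
          simp [integralLinear, monomial]
        simp_rw [h1, h2]
        exact tendsto_const_nhds
      · rw [tendsto_iff_dist_tendsto_zero]
        refine squeeze_zero' (Eventually.of_forall fun k => dist_nonneg) ?_
          (tendsto_one_div_add_atTop_nhds_zero_nat (𝕜 := ℝ))
        filter_upwards [eventually_ge_atTop q] with k hk
        exact (mem_microstates_iff.1 (hx k) q hq hk i).le
  obtain ⟨k, hk⟩ := ((Metric.tendsto_nhds.1 hlim) ε hε).exists
  rw [Real.dist_eq] at hk
  exact absurd hk (not_lt.2 (hbad k).le)

end Configurations

section PressureUpperBound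

variable {R : ℝ} {n : ℕ}

theorem card_perm_tuples (n N : ℕ) :
    Fintype.card (Fin n → Equiv.Perm (Fin N)) = N.factorial ^ n := by
  simp [Fintype.card_perm]

theorem marginal_pi (ν : Fin n → Measure (Interval R)) [∀ i, IsProbabilityMeasure (ν i)] :
    marginal (Measure.pi ν) = ν := by
  ext1 i
  exact (measurePreserving_eval ν i).map_eq

theorem exists_kappa_close_of_mem_nearShuffles (h : C(Box R n, ℝ)) {ε : ℝ} (hε : 0 < ε) :
    ∃ η : ℝ, 0 < η ∧ ∀ (N : ℕ) (ξ : Fin n → Fin N → Interval R) (y : Fin N → Box R n)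
      (τ : Fin n → Equiv.Perm (Fin N)),
      kappa (fun j => ∑ i, |((shuffle τ y j i : Interval R) : ℝ) - ξ i j|) < η →
      ∀ σ : Fin n → Equiv.Perm (Fin N),
      |kappa (fun j => h (shuffle σ (shuffle τ y) j)) -
        kappa (fun j => h fun i => permute σ ξ i j)| ≤ ε := by
  obtain ⟨η, hη, H⟩ := exists_abs_kappa_sub_le h hε
  refine ⟨η, hη, fun N ξ y τ hτ σ => ?_⟩
  have := kappa_shuffle_sub σ (shuffle τ y) fun j i => ξ i j
  rw [← this] at hτ
  exact H N _ _ hτ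

theorem eventually_half_le {u : ℕ → ENNReal} (hu : Tendsto u atTop (𝓝 1)) :
    ∀ᶠ N in atTop, 2⁻¹ ≤ u N :=
  (hu.eventually_const_lt (by simp : (2 : ENNReal)⁻¹ < 1)).mono fun _ h => h.le

theorem lintegral_exp_sum_pi {X : Type*} [MeasurableSpace X] (ρ : Measure X)
    [IsProbabilityMeasure ρ] {f : X → ℝ} (hf : Measurable f)
    (hi : Integrable (fun x => Real.exp (f x)) ρ) (N : ℕ) (c : ℝ) :
    ∫⁻ y : Fin N → X, ENNReal.ofReal (Real.exp (N * (kappa (fun j => f (y j)) + c)))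
        ∂Measure.pi (fun _ => ρ) =
      ENNReal.ofReal ((Real.exp c * ∫ x, Real.exp (f x) ∂ρ) ^ N) := by
  have e1 : ∀ y : Fin N → X, ENNReal.ofReal (Real.exp (N * (kappa (fun j => f (y j)) + c))) =
      ∏ j, ENNReal.ofReal (Real.exp c * Real.exp (f (y j))) := fun y => by
    rw [← ENNReal.ofReal_prod_of_nonneg fun j _ => by positivity]
    simp_rw [← Real.exp_add]
    rw [← Real.exp_sum, mul_add, natCast_mul_kappa, Finset.sum_add_distrib]
    simp [add_comm]
  simp_rw [e1]
  rw [lintegral_fin_prod_eq_prod (f := fun _ x => ENNReal.ofReal (Real.exp c * Real.exp (f x)))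
    fun _ => by fun_prop]
  rw [← ofReal_integral_eq_lintegral_ofReal (hi.const_mul _) (ae_of_all _ fun x => by positivity),
    integral_const_mul, Finset.prod_const, Finset.card_fin, ENNReal.ofReal_pow]
  have := integral_nonneg (μ := ρ) (f := fun x => Real.exp (f x)) fun x => (Real.exp_pos _).le
  positivity

theorem mutualPressure_le_log_integral_exp {ν : Fin n → Measure (Interval R)}
    [∀ i, IsProbabilityMeasure (ν i)] {Ξ : (N : ℕ) → Fin n → Fin N → Interval R}
    (hΞ : IsApproximating ν Ξ) (h : C(Box R n, ℝ)) :
    mutualPressure Ξ h ≤ ((Real.log (∫ x, Real.exp (h x) ∂Measure.pi ν) : ℝ) : EReal) := by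
  set π := Measure.pi ν with hπ
  have hi : Integrable (fun x => Real.exp (h x)) π :=
    integrable_exp_of_abs_le h.continuous.measurable h.norm_coe_le_norm
  set Z := ∫ x, Real.exp (h x) ∂π with hZ
  have hZ0 : 0 < Z := integral_exp_pos hi
  have hΞ' : IsApproximating (marginal π) Ξ := by rwa [hπ, marginal_pi]
  refine EReal.le_of_forall_lt_iff_le.1 fun z hz => ?_
  rw [EReal.coe_lt_coe_iff] at hz
  set ε := (z - Real.log Z) / 2 with hε
  have hε0 : 0 < ε := by rw [hε]; linarith
  obtain ⟨η, hη, H⟩ := exists_kappa_close_of_mem_nearShuffles h hε0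
  have hG := eventually_half_le (tendsto_pi_of_ae_eventually_mem π
    (fun N => measurableSet_nearShuffles (Ξ N) η) (ae_eventually_mem_nearShuffles hΞ' hη))
  have hlog : ∀ᶠ N : ℕ in atTop, Real.log 2 / N < ε :=
    (tendsto_const_div_atTop_nhds_zero_nat (Real.log 2)).eventually_lt_const hε0
  refine limsup_le_of_le (by isBoundedDefault) ?_
  filter_upwards [hG, hlog, eventually_gt_atTop 0] with N hN hlogN hN0
  have hNpos : (0 : ℝ) < N := by exact_mod_cast hN0
  rw [EReal.coe_le_coe_iff]
  set T := ∑ σ : Fin n → Equiv.Perm (Fin N),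
    Real.exp ((N : ℝ) * kappa (fun j => h (fun i => permute σ (Ξ N) i j))) with hT
  have hT0 : 0 < T := Finset.sum_pos (fun σ _ => Real.exp_pos _) Finset.univ_nonempty
  have key := sum_mul_measure_le_lintegral ν (ι := Fin N)
    (F := fun y => ENNReal.ofReal (Real.exp (N * (kappa (fun j => h (y j)) + ε))))
    (by unfold kappa; fun_prop) (G := nearShuffles (Ξ N) η)
    (c := fun σ => ENNReal.ofReal (Real.exp ((N : ℝ) * kappa
      (fun j => h (fun i => permute σ (Ξ N) i j))))) (by
      rintro y ⟨τ, hτ⟩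
      refine ⟨τ, fun σ => ENNReal.ofReal_le_ofReal (Real.exp_le_exp.2 ?_)⟩
      have := (abs_le.1 (H N (Ξ N) y τ hτ σ)).1
      gcongr
      linarith)
  rw [lintegral_exp_sum_pi π h.continuous.measurable hi, card_perm_tuples,
    ← ENNReal.ofReal_sum_of_nonneg fun σ _ => (Real.exp_pos _).le] at key
  have key2 : ENNReal.ofReal (T * 2⁻¹) ≤
      ENNReal.ofReal ((N.factorial : ℝ) ^ n * (Real.exp ε * Z) ^ N) := by
    rw [ENNReal.ofReal_mul hT0.le, ENNReal.ofReal_mul (by positivity)]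
    have e1 : ENNReal.ofReal (2⁻¹ : ℝ) = 2⁻¹ := by
      rw [ENNReal.ofReal_inv_of_pos (by norm_num)]; simp
    have e2 : ENNReal.ofReal ((N.factorial : ℝ) ^ n) = ((N.factorial ^ n : ℕ) : ENNReal) := by
      rw [← Nat.cast_pow, ENNReal.ofReal_natCast]
    rw [e1, e2]
    exact (mul_le_mul_right hN _).trans key
  rw [ENNReal.ofReal_le_ofReal_iff (by positivity)] at key2
  have hfac : (0 : ℝ) < (N.factorial : ℝ) ^ n := by positivity
  have key3 : 1 / (N.factorial : ℝ) ^ n * T ≤ 2 * (Real.exp ε * Z) ^ N := by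
    rw [one_div_mul_eq_div, div_le_iff₀ hfac]; linarith
  have key4 := Real.log_le_log (by positivity) key3
  have hpow : (Real.exp ε * Z) ^ N ≠ 0 := by positivity
  rw [Real.log_mul two_ne_zero hpow, Real.log_pow,
    Real.log_mul (Real.exp_pos _).ne' hZ0.ne', Real.log_exp] at key4
  calc 1 / (N : ℝ) * Real.log (1 / (N.factorial : ℝ) ^ n * T)
      ≤ 1 / (N : ℝ) * (Real.log 2 + N * (ε + Real.log Z)) := by gcongr
    _ = Real.log 2 / N + (ε + Real.log Z) := by field_simp
    _ ≤ z := by linarith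

theorem klDiv_le_legendreISym (μ : Measure (Box R n)) [IsProbabilityMeasure μ]
    {Ξ : (N : ℕ) → Fin n → Fin N → Interval R} (hΞ : IsApproximating (marginal μ) Ξ) :
    ((InformationTheory.klDiv μ (Measure.pi (marginal μ)) : ENNReal) : EReal) ≤
      legendreISym μ Ξ := by
  have hprob : ∀ i, IsProbabilityMeasure (marginal μ i) := fun i =>
    Measure.isProbabilityMeasure_map (measurable_pi_apply i).aemeasurable
  have hle : ∀ h : C(Box R n, ℝ), ((∫ x, h x ∂μ
      - Real.log (∫ x, Real.exp (h x) ∂Measure.pi (marginal μ)) : ℝ) : EReal) ≤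
        legendreISym μ Ξ := fun h => by
    refine le_trans ?_ (le_iSup _ h)
    rw [EReal.coe_sub]
    exact EReal.sub_le_sub le_rfl (mutualPressure_le_log_integral_exp hΞ h)
  have h0 : (0 : EReal) ≤ legendreISym μ Ξ := by
    have := hle 0
    simpa using this
  induction hL : legendreISym μ Ξ with
  | bot => rw [hL] at h0; simp at h0
  | top => exact le_top
  | coe C =>
    simp only [hL, EReal.coe_le_coe_iff] at hle
    rw [hL] at h0
    have := klDiv_le_of_forall_continuous hle
    calc _ ≤ ((ENNReal.ofReal C : ENNReal) : EReal) := by exact_mod_cast this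
      _ = C := by
        rw [EReal.coe_ennreal_ofReal, max_eq_left (by exact_mod_cast h0)]

end PressureUpperBound

section Legendre

variable {R : ℝ} {n : ℕ}

theorem symRate_le_mutualPressure (μ : Measure (Box R n))
    (Ξ : (N : ℕ) → Fin n → Fin N → Interval R) (h : C(Box R n, ℝ)) {m : ℕ} {δ a : ℝ}
    (H : ∀ N : ℕ, 0 < N → ∀ x ∈ microstates μ N m δ, a ≤ kappa (fun j => h fun i => x i j)) :
    symRate μ Ξ m δ ≤ mutualPressure Ξ h + ((-a : ℝ) : EReal) := by
  have hadd : limsup (fun N : ℕ =>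
      (((1 / (N : ℝ)) * Real.log ((1 / ((N.factorial : ℝ) ^ n)) *
        ∑ σ : Fin n → Equiv.Perm (Fin N),
          Real.exp ((N : ℝ) * kappa (fun j => h (fun i => permute σ (Ξ N) i j)))) : ℝ) : EReal)
        + ((-a : ℝ) : EReal)) atTop ≤ mutualPressure Ξ h + ((-a : ℝ) : EReal) := by
    refine (EReal.limsup_add_le ?_ ?_).trans ?_
    · right; simp [limsup_const]
    · right; simp [limsup_const]
    · rw [limsup_const]; rfl
  refine le_trans ?_ hadd
  refine limsup_le_limsup ?_
  filter_upwards [eventually_gt_atTop 0] with N hN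
  have hNpos : (0 : ℝ) < N := by exact_mod_cast hN
  set T := ∑ σ : Fin n → Equiv.Perm (Fin N),
    Real.exp ((N : ℝ) * kappa (fun j => h (fun i => permute σ (Ξ N) i j))) with hT
  have hT0 : 0 < T := Finset.sum_pos (fun σ _ => Real.exp_pos _) Finset.univ_nonempty
  have hfac : (0 : ℝ) < (N.factorial : ℝ) ^ n := by positivity
  classical
  have hcard : ((symMicrostates μ Ξ N m δ).ncard : ℝ) * Real.exp (N * a) ≤ T := by
    rw [Set.ncard_eq_toFinset_card', ← nsmul_eq_mul]
    calc _ ≤ ∑ σ ∈ (symMicrostates μ Ξ N m δ).toFinset,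
          Real.exp ((N : ℝ) * kappa (fun j => h (fun i => permute σ (Ξ N) i j))) := by
          refine Finset.card_nsmul_le_sum _ _ _ fun σ hσ => ?_
          rw [Set.mem_toFinset] at hσ
          have := H N hN _ hσ
          gcongr
      _ ≤ T := Finset.sum_le_sum_of_subset_of_nonneg (Finset.subset_univ _)
          fun σ _ _ => (Real.exp_pos _).le
  have hq : ((symMicrostates μ Ξ N m δ).ncard : ENNReal) / ((N.factorial : ENNReal) ^ n) ≤
      ENNReal.ofReal (1 / (N.factorial : ℝ) ^ n * T * Real.exp (-(N * a))) := by
    have e : ((symMicrostates μ Ξ N m δ).ncard : ENNReal) / ((N.factorial : ENNReal) ^ n) =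
        ENNReal.ofReal ((symMicrostates μ Ξ N m δ).ncard / (N.factorial : ℝ) ^ n) := by
      rw [ENNReal.ofReal_div_of_pos hfac, ENNReal.ofReal_natCast,
        ENNReal.ofReal_pow (by positivity), ENNReal.ofReal_natCast]
    rw [e]
    refine ENNReal.ofReal_le_ofReal ?_
    rw [Real.exp_neg, one_div_mul_eq_div, ← div_eq_mul_inv, div_div,
      div_le_div_iff₀ hfac (by positivity)]
    calc _ = ((symMicrostates μ Ξ N m δ).ncard * Real.exp (N * a)) * (N.factorial : ℝ) ^ n := by
          ring
      _ ≤ _ := by gcongr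
  calc _ ≤ (((1 / (N : ℝ)) : ℝ) : EReal) *
        ENNReal.log (ENNReal.ofReal (1 / (N.factorial : ℝ) ^ n * T * Real.exp (-(N * a)))) :=
        mul_le_mul_of_nonneg_left (ENNReal.log_monotone hq) (by positivity)
    _ = _ := by
        rw [ENNReal.log_ofReal_of_pos (by positivity), ← EReal.coe_mul, ← EReal.coe_add,
          Real.log_mul (by positivity) (Real.exp_pos _).ne', Real.log_exp, EReal.coe_eq_coe_iff]
        field_simp

theorem legendreISym_le_ISym (μ : Measure (Box R n)) [IsProbabilityMeasure μ]
    (Ξ : (N : ℕ) → Fin n → Fin N → Interval R) : legendreISym μ Ξ ≤ ISym μ Ξ := by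
  refine iSup_le fun h => ?_
  rw [ISym, ← EReal.neg_le_neg_iff, neg_neg, EReal.neg_sub (by simp) (by simp)]
  have key : ∀ ε : ℝ, 0 < ε → (⨅ (m : ℕ) (δ : ℝ) (_ : 0 < δ), symRate μ Ξ m δ) ≤
      mutualPressure Ξ h + ((-(∫ x, h x ∂μ - ε) : ℝ) : EReal) := by
    intro ε hε
    obtain ⟨m, δ, hδ, H⟩ := exists_microstates_kappa_close μ h hε
    refine ((iInf_le _ m).trans ((iInf_le _ δ).trans (iInf_le _ hδ))).trans ?_
    refine symRate_le_mutualPressure μ Ξ h fun N hN x hx => ?_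
    have := (abs_le.1 (H N hN x hx)).1
    linarith
  rw [add_comm, ← sub_eq_add_neg]
  induction hP : mutualPressure Ξ h with
  | top => simp
  | bot =>
    have := key 1 one_pos
    rw [hP] at this
    simpa using this
  | coe p =>
    rw [hP] at key
    rw [← EReal.coe_sub]
    refine EReal.le_of_forall_lt_iff_le.1 fun z hz => ?_
    rw [EReal.coe_lt_coe_iff] at hz
    have := key (z - (p - ∫ x, h x ∂μ)) (by linarith)
    rw [← EReal.coe_add] at this
    refine this.trans (EReal.coe_le_coe_iff.2 (by linarith))

end Legendre

section MicrostatesLowerBound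

variable {R : ℝ} {n : ℕ}

theorem exists_forall_monomial_close (m : ℕ) {ε : ℝ} (hε : 0 < ε) :
    ∃ η : ℝ, 0 < η ∧ ∀ k ∈ Finset.Icc 1 m, ∀ (i : Fin k → Fin n) (N : ℕ)
      (ξ : Fin n → Fin N → Interval R) (y : Fin N → Box R n) (τ : Fin n → Equiv.Perm (Fin N)),
      kappa (fun j => ∑ i, |((shuffle τ y j i : Interval R) : ℝ) - ξ i j|) < η →
      ∀ σ : Fin n → Equiv.Perm (Fin N),
      |kappa (fun j => (monomial i : C(Box R n, ℝ)) (shuffle σ (shuffle τ y) j)) -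
        kappa (fun j => (monomial i : C(Box R n, ℝ)) fun i => permute σ ξ i j)| ≤ ε := by
  have h : ∀ᶠ η : ℝ in 𝓝[>] 0, ∀ k ∈ Finset.Icc 1 m, ∀ (i : Fin k → Fin n) (N : ℕ)
      (ξ : Fin n → Fin N → Interval R) (y : Fin N → Box R n) (τ : Fin n → Equiv.Perm (Fin N)),
      kappa (fun j => ∑ i, |((shuffle τ y j i : Interval R) : ℝ) - ξ i j|) < η →
      ∀ σ : Fin n → Equiv.Perm (Fin N),
      |kappa (fun j => (monomial i : C(Box R n, ℝ)) (shuffle σ (shuffle τ y) j)) -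
        kappa (fun j => (monomial i : C(Box R n, ℝ)) fun i => permute σ ξ i j)| ≤ ε := by
    rw [Filter.eventually_all_finset]
    intro k _
    rw [Filter.eventually_all]
    intro i
    obtain ⟨η, hη, H⟩ :=
      exists_kappa_close_of_mem_nearShuffles (monomial i : C(Box R n, ℝ)) hε
    filter_upwards [Ioo_mem_nhdsGT hη] with η' hη' N ξ y τ hτ
    exact H N ξ y τ (hτ.trans hη'.2)
  obtain ⟨η, h1, h2⟩ := (h.and self_mem_nhdsWithin).exists
  exact ⟨η, h2, h1⟩

open Classical in
/-- The product measure of the microstates near `ξ` is bounded by the proportion of discrete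
microstates. -/
theorem pi_microstates_le_ncard (ν : Fin n → Measure (Interval R))
    [∀ i, IsProbabilityMeasure (ν i)] (μ : Measure (Box R n))
    (Ξ : (N : ℕ) → Fin n → Fin N → Interval R) (m : ℕ) {δ : ℝ} (hδ : 0 < δ) :
    ∃ η : ℝ, 0 < η ∧ ∀ N : ℕ,
      Measure.pi (fun _ : Fin N => Measure.pi ν)
        ({y | (fun i j => y j i) ∈ microstates μ N m (δ / 2)} ∩ nearShuffles (Ξ N) η) ≤
      ((symMicrostates μ Ξ N m δ).ncard : ENNReal) / ((N.factorial : ENNReal) ^ n) := by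
  obtain ⟨η, hη, H⟩ := exists_forall_monomial_close (R := R) (n := n) m (half_pos hδ)
  refine ⟨η, hη, fun N => ?_⟩
  set E : Set (Fin N → Box R n) :=
    {y | (fun i j => y j i) ∈ microstates μ N m (δ / 2)} ∩ nearShuffles (Ξ N) η with hE
  have hEm : MeasurableSet E :=
    (measurableSet_microstates μ N m (δ / 2)).inter (measurableSet_nearShuffles _ _)
  have key := lintegral_le_sum ν (ι := Fin N) (F := E.indicator 1)
    (measurable_one.indicator hEm)
    (c := (symMicrostates μ Ξ N m δ).indicator fun _ => 1) (by
      intro y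
      by_cases hy : y ∈ nearShuffles (Ξ N) η
      · obtain ⟨τ, hτ⟩ := hy
        refine ⟨τ, fun σ => ?_⟩
        by_cases hs : shuffle σ (shuffle τ y) ∈ E
        · have hσ : σ ∈ symMicrostates μ Ξ N m δ := by
            intro k hk hkm i
            have hs' : (fun i j => shuffle σ (shuffle τ y) j i) ∈ microstates μ N m (δ / 2) := hs.1
            have h1 := mem_microstates_iff.1 hs' k hk hkm i
            have h2 := H k (Finset.mem_Icc.2 ⟨hk, hkm⟩) i N (Ξ N) y τ hτ σ
            change |kappa (fun j => (monomial i : C(Box R n, ℝ)) fun i => permute σ (Ξ N) i j)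
              - ∫ y, (monomial i : C(Box R n, ℝ)) y ∂μ| < δ
            rw [abs_lt] at h1 ⊢
            rw [abs_le] at h2
            constructor <;> linarith [h1.1, h1.2, h2.1, h2.2]
          simp [hσ, hs]
        · simp [hs]
      · refine ⟨1, fun σ => ?_⟩
        have : shuffle σ (shuffle 1 y) ∉ E := fun hs =>
          hy (shuffle_mem_nearShuffles (shuffle_mem_nearShuffles hs.2))
        simp [this])
  rw [lintegral_indicator_one hEm, card_perm_tuples] at key
  have hsum : ∑ σ : Fin n → Equiv.Perm (Fin N),
      (symMicrostates μ Ξ N m δ).indicator (fun _ => (1 : ENNReal)) σ =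
        (symMicrostates μ Ξ N m δ).ncard := by
    simp only [Set.indicator_apply]
    rw [Set.ncard_eq_toFinset_card', Finset.sum_boole]
    congr 2
    ext σ; simp
  rw [hsum] at key
  rw [ENNReal.le_div_iff_mul_le (by simp [Nat.factorial_ne_zero]) (by simp), mul_comm]
  exact_mod_cast key

theorem ISym_le_klDiv (μ : Measure (Box R n)) [IsProbabilityMeasure μ]
    {Ξ : (N : ℕ) → Fin n → Fin N → Interval R} (hΞ : IsApproximating (marginal μ) Ξ) :
    ISym μ Ξ ≤
      ((InformationTheory.klDiv μ (Measure.pi (marginal μ)) : ENNReal) : EReal) := by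
  have hprob : ∀ i, IsProbabilityMeasure (marginal μ i) := fun i =>
    Measure.isProbabilityMeasure_map (measurable_pi_apply i).aemeasurable
  set π := Measure.pi (marginal μ) with hπ
  by_cases htop : InformationTheory.klDiv μ π = ⊤
  · simp [htop]
  obtain ⟨hac, hint⟩ := InformationTheory.klDiv_ne_top_iff.1 htop
  set S := ∫ x, llr μ π x ∂μ with hS
  have hkl : ((InformationTheory.klDiv μ π : ENNReal) : EReal) = (S : EReal) := by
    rw [hS, ← InformationTheory.toReal_klDiv_of_measure_eq hac (by simp),
      EReal.coe_ennreal_toReal htop]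
  rw [hkl, ISym, EReal.neg_le]
  refine le_iInf fun m => le_iInf fun δ => le_iInf fun hδ => ?_
  obtain ⟨η, hη, H⟩ := pi_microstates_le_ncard (marginal μ) μ Ξ m hδ
  rw [← EReal.coe_neg]
  refine EReal.ge_of_forall_gt_iff_ge.1 fun z hz => ?_
  rw [EReal.coe_lt_coe_iff] at hz
  set ε := (-S - z) / 2 with hε
  have hε0 : 0 < ε := by rw [hε]; linarith
  let E : (N : ℕ) → Set (Fin N → Box R n) := fun N =>
    ({y | (fun i j => y j i) ∈ microstates μ N m (δ / 2)} ∩ nearShuffles (Ξ N) η) ∩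
      {y | kappa (fun j => llr μ π (y j)) < S + ε}
  have hEm : ∀ N, MeasurableSet (E N) := fun N => by
    refine ((measurableSet_microstates μ N m (δ / 2)).inter
      (measurableSet_nearShuffles _ _)).inter (measurableSet_lt ?_ measurable_const)
    have := measurable_llr μ π
    unfold kappa
    fun_prop
  have hlim : Tendsto (fun N => Measure.pi (fun _ : Fin N => μ) (E N)) atTop (𝓝 1) := by
    refine tendsto_pi_of_ae_eventually_mem μ hEm ?_
    filter_upwards [ae_eventually_mem_microstates μ m (half_pos hδ),
      ae_eventually_mem_nearShuffles hΞ hη, ae_tendsto_kappa μ (measurable_llr μ π) hint]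
      with ω h1 h2 h3
    filter_upwards [h1, h2, h3.eventually_lt_const (by linarith : S < S + ε)] with N a1 a2 a3
    exact ⟨⟨a1, a2⟩, a3⟩
  have hlog : ∀ᶠ N : ℕ in atTop, Real.log 2 / N < ε :=
    (tendsto_const_div_atTop_nhds_zero_nat (Real.log 2)).eventually_lt_const hε0
  refine le_limsup_of_frequently_le (Eventually.frequently ?_) (by isBoundedDefault)
  filter_upwards [eventually_half_le hlim, hlog, eventually_gt_atTop 0] with N hN hlogN hN0
  have hNpos : (0 : ℝ) < N := by exact_mod_cast hN0
  have h1 := pi_le_mul_pi_of_prod_exp_llr_le hac (hEm N)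
    (K := ENNReal.ofReal (Real.exp (N * (S + ε)))) (by
      intro y hy
      rw [← ENNReal.ofReal_prod_of_nonneg fun j _ => (Real.exp_pos _).le, ← Real.exp_sum,
        ← natCast_mul_kappa]
      refine ENNReal.ofReal_le_ofReal (Real.exp_le_exp.2 ?_)
      have hlt : kappa (fun j => llr μ π (y j)) < S + ε := hy.2
      gcongr)
  have h2 : ENNReal.ofReal (2⁻¹ * Real.exp (-(N * (S + ε)))) ≤
      ((symMicrostates μ Ξ N m δ).ncard : ENNReal) / ((N.factorial : ENNReal) ^ n) := by
    have hsub : Measure.pi (fun _ : Fin N => π) (E N) ≤ _ :=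
      (measure_mono Set.inter_subset_left).trans (H N)
    refine le_trans ?_ hsub
    have h3 := hN.trans h1
    have e1 : ENNReal.ofReal (2⁻¹ : ℝ) = 2⁻¹ := by
      rw [ENNReal.ofReal_inv_of_pos (by norm_num)]; simp
    rw [ENNReal.ofReal_mul (by norm_num), e1, Real.exp_neg,
      ENNReal.ofReal_inv_of_pos (Real.exp_pos _), ← div_eq_mul_inv]
    refine ENNReal.div_le_of_le_mul ?_
    rwa [mul_comm]
  calc (z : EReal) ≤ (((1 / (N : ℝ)) : ℝ) : EReal) *
        ENNReal.log (ENNReal.ofReal (2⁻¹ * Real.exp (-(N * (S + ε))))) := by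
        rw [ENNReal.log_ofReal_of_pos (by positivity), ← EReal.coe_mul, EReal.coe_le_coe_iff,
          Real.log_mul (by norm_num) (Real.exp_pos _).ne', Real.log_exp, Real.log_inv]
        have : 1 / (N : ℝ) * (-Real.log 2 + -(N * (S + ε))) = -(Real.log 2 / N) - (S + ε) := by
          field_simp
          ring
        rw [this]
        linarith
    _ ≤ _ := mul_le_mul_of_nonneg_left (ENNReal.log_monotone h2) (by positivity)

end MicrostatesLowerBound

section Entropy

open Classical in
theorem entropy_eq_llr {X : Type*} [MeasurableSpace X] (L μ : Measure X) [IsFiniteMeasure L]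
    [IsFiniteMeasure μ] :
    entropy L μ = if μ ≪ L ∧ Integrable (llr μ L) μ
      then ((-∫ x, llr μ L x ∂μ : ℝ) : EReal) else ⊥ := by
  unfold entropy
  by_cases hac : μ ≪ L
  · simp only [hac, true_and]
    rw [← integral_rnDeriv_mul_log hac, ← integrable_rnDeriv_mul_log_iff hac]
  · simp [hac]

variable {R : ℝ} {n : ℕ}

theorem lebesgueInterval_univ (R : ℝ) :
    lebesgueInterval R Set.univ = ENNReal.ofReal (2 * R) := by
  rw [lebesgueInterval, (MeasurableEmbedding.subtype_coe measurableSet_Icc).comap_apply]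
  simp only [Set.image_univ, Subtype.range_coe, Real.volume_Icc]
  ring_nf

instance isFiniteMeasure_lebesgueInterval (R : ℝ) : IsFiniteMeasure (lebesgueInterval R) :=
  ⟨by rw [lebesgueInterval_univ]; exact ENNReal.ofReal_lt_top⟩

instance isFiniteMeasure_lebesgueBox (R : ℝ) (n : ℕ) : IsFiniteMeasure (lebesgueBox R n) := by
  unfold lebesgueBox; infer_instance

theorem ac_and_integrable_marginal (hR : 0 < R) {μ : Measure (Box R n)} [IsFiniteMeasure μ]
    (hac : μ ≪ lebesgueBox R n) (hint : Integrable (llr μ (lebesgueBox R n)) μ) (i : Fin n) :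
    marginal μ i ≪ lebesgueInterval R ∧
      Integrable (llr (marginal μ i) (lebesgueInterval R)) (marginal μ i) := by
  have hm : Measurable fun x : Box R n => x i := measurable_pi_apply i
  set c : ENNReal := ∏ _j ∈ Finset.univ.erase i, lebesgueInterval R Set.univ with hc
  have hmap : (lebesgueBox R n).map (fun x => x i) = c • lebesgueInterval R :=
    Measure.pi_map_eval (fun _ : Fin n => lebesgueInterval R) i
  have hc0 : c ≠ 0 := by
    rw [hc, Finset.prod_ne_zero_iff]
    intro j _
    rw [lebesgueInterval_univ]
    simpa using hR
  have hct : c ≠ ⊤ := ENNReal.prod_ne_top fun j _ => measure_ne_top _ _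
  have h1 : marginal μ i ≪ c • lebesgueInterval R := by
    rw [← hmap]; exact hac.map hm
  have h2 := InformationTheory.integrable_llr_map hac hm hint
  rw [hmap] at h2
  have hfin : IsFiniteMeasure (marginal μ i) := by unfold marginal; infer_instance
  have h3 : marginal μ i ≪ lebesgueInterval R :=
    h1.trans (Measure.smul_absolutelyContinuous)
  refine ⟨h3, ?_⟩
  have h4 : Integrable (fun x => llr (marginal μ i) (lebesgueInterval R) x
      - Real.log c.toReal) (marginal μ i) :=
    (integrable_congr (llr_smul_right h3 c hc0 hct)).1 h2
  exact (h4.add (integrable_const (Real.log c.toReal))).congr (ae_of_all _ fun x => by simp)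

theorem pi_marginal_eq_withDensity {ν : Fin n → Measure (Interval R)}
    [∀ i, IsProbabilityMeasure (ν i)] (hac : ∀ i, ν i ≪ lebesgueInterval R) :
    Measure.pi ν = (lebesgueBox R n).withDensity
      fun x => ∏ i, (ν i).rnDeriv (lebesgueInterval R) (x i) := by
  have hν : ∀ i, (lebesgueInterval R).withDensity ((ν i).rnDeriv (lebesgueInterval R)) = ν i :=
    fun i => Measure.withDensity_rnDeriv_eq _ _ (hac i)
  have : ∀ i, SigmaFinite
      ((lebesgueInterval R).withDensity ((ν i).rnDeriv (lebesgueInterval R))) := fun i => by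
    rw [hν i]; infer_instance
  have h := pi_withDensity (μ := fun _ : Fin n => lebesgueInterval R)
    (f := fun i => (ν i).rnDeriv (lebesgueInterval R)) fun i => Measure.measurable_rnDeriv _ _
  simp only [hν] at h
  exact h

theorem ae_of_ae_marginal {μ : Measure (Box R n)} {i : Fin n} {p : Interval R → Prop}
    (h : ∀ᵐ y ∂marginal μ i, p y) : ∀ᵐ x ∂μ, p (x i) :=
  ae_of_ae_map (measurable_pi_apply i).aemeasurable h

theorem measurable_prod_rnDeriv (ν : Fin n → Measure (Interval R)) :
    Measurable fun x : Box R n => ∏ i, (ν i).rnDeriv (lebesgueInterval R) (x i) :=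
  Finset.measurable_fun_prod _ fun i _ =>
    (Measure.measurable_rnDeriv (ν i) (lebesgueInterval R)).comp (measurable_pi_apply i)

theorem ac_pi_marginal {μ : Measure (Box R n)} [IsProbabilityMeasure μ]
    (hac : μ ≪ lebesgueBox R n) (hac' : ∀ i, marginal μ i ≪ lebesgueInterval R) :
    μ ≪ Measure.pi (marginal μ) := by
  have hprob : ∀ i, IsProbabilityMeasure (marginal μ i) := fun i =>
    Measure.isProbabilityMeasure_map (measurable_pi_apply i).aemeasurable
  have hpos : ∀ᵐ x ∂μ, ∀ i, 0 < (marginal μ i).rnDeriv (lebesgueInterval R) (x i) :=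
    ae_all_iff.2 fun i => ae_of_ae_marginal (Measure.rnDeriv_pos (hac' i))
  refine Measure.AbsolutelyContinuous.mk fun s _ hs0 => ?_
  rw [pi_marginal_eq_withDensity hac', withDensity_apply_eq_zero
    (measurable_prod_rnDeriv _)] at hs0
  have h1 := hac hs0
  rw [← nonpos_iff_eq_zero, ← h1]
  refine measure_mono_ae ?_
  filter_upwards [hpos] with x hx hxs
  exact ⟨Finset.prod_ne_zero_iff.2 fun i _ => (hx i).ne', hxs⟩

theorem llr_chain {X : Type*} [MeasurableSpace X] {μ π κ : Measure X} [SigmaFinite μ]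
    [SigmaFinite π] [SigmaFinite κ] (hμπ : μ ≪ π) (hπκ : π ≪ κ) :
    llr μ κ =ᵐ[μ] fun x => llr μ π x + llr π κ x := by
  filter_upwards [(hμπ.trans hπκ).ae_le (Measure.rnDeriv_mul_rnDeriv (κ := κ) hμπ),
    Measure.rnDeriv_pos hμπ, hμπ.ae_le (Measure.rnDeriv_lt_top μ π),
    hμπ.ae_le (Measure.rnDeriv_pos hπκ),
    (hμπ.trans hπκ).ae_le (Measure.rnDeriv_lt_top π κ)] with x h1 h2 h3 h4 h5
  simp only [llr]
  rw [← h1, Pi.mul_apply, ENNReal.toReal_mul, Real.log_mul]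
  · exact (ENNReal.toReal_pos h2.ne' h3.ne).ne'
  · exact (ENNReal.toReal_pos h4.ne' h5.ne).ne'

theorem llr_lebesgueBox_eq {μ : Measure (Box R n)} [IsProbabilityMeasure μ]
    (hac : μ ≪ lebesgueBox R n) (hac' : ∀ i, marginal μ i ≪ lebesgueInterval R) :
    llr μ (lebesgueBox R n) =ᵐ[μ] fun x => llr μ (Measure.pi (marginal μ)) x +
      ∑ i, llr (marginal μ i) (lebesgueInterval R) (x i) := by
  have hprob : ∀ i, IsProbabilityMeasure (marginal μ i) := fun i =>
    Measure.isProbabilityMeasure_map (measurable_pi_apply i).aemeasurable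
  have hπL : (Measure.pi (marginal μ) : Measure (Box R n)) ≪ lebesgueBox R n := by
    rw [pi_marginal_eq_withDensity hac']
    exact withDensity_absolutelyContinuous _ _
  have hchain := llr_chain (ac_pi_marginal hac hac') hπL
  have hpos : ∀ᵐ x ∂μ, ∀ i, 0 < (marginal μ i).rnDeriv (lebesgueInterval R) (x i) :=
    ae_all_iff.2 fun i => ae_of_ae_marginal (Measure.rnDeriv_pos (hac' i))
  have hlt : ∀ᵐ x ∂μ, ∀ i, (marginal μ i).rnDeriv (lebesgueInterval R) (x i) < ⊤ :=
    ae_all_iff.2 fun i => ae_of_ae_marginal ((hac' i).ae_le (Measure.rnDeriv_lt_top _ _))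
  have hden : (Measure.pi (marginal μ)).rnDeriv (lebesgueBox R n) =ᵐ[lebesgueBox R n]
      fun x => ∏ i, (marginal μ i).rnDeriv (lebesgueInterval R) (x i) := by
    conv_lhs => rw [pi_marginal_eq_withDensity hac']
    exact Measure.rnDeriv_withDensity _ (measurable_prod_rnDeriv _)
  filter_upwards [hpos, hlt, hac.ae_le hden, hchain] with x h1 h2 h3 h4
  have h5 : llr (Measure.pi (marginal μ)) (lebesgueBox R n) x =
      ∑ i, llr (marginal μ i) (lebesgueInterval R) (x i) := by
    refine (congrArg (fun t : ENNReal => Real.log t.toReal) h3).trans ?_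
    rw [ENNReal.toReal_prod, Real.log_prod]
    · rfl
    · exact fun i _ => (ENNReal.toReal_pos (h1 i).ne' (h2 i).ne).ne'
  rw [h4, h5]

theorem ereal_coe_sum {ι : Type*} (s : Finset ι) (f : ι → ℝ) :
    ((∑ i ∈ s, f i : ℝ) : EReal) = ∑ i ∈ s, (f i : EReal) :=
  map_sum (⟨⟨((↑) : ℝ → EReal), EReal.coe_zero⟩, EReal.coe_add⟩ : ℝ →+ EReal) f s

/-- The entropy of a measure on the box in terms of its marginals and its relative entropy. -/
theorem entropyBox_eq_neg_klDiv_add (hR : 0 < R) (μ : Measure (Box R n))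
    [IsProbabilityMeasure μ] :
    entropyBox μ =
      -((InformationTheory.klDiv μ (Measure.pi (marginal μ)) : ENNReal) : EReal)
        + ∑ i, entropyInterval (marginal μ i) := by
  have hprob : ∀ i, IsProbabilityMeasure (marginal μ i) := fun i =>
    Measure.isProbabilityMeasure_map (measurable_pi_apply i).aemeasurable
  by_cases hm : ∀ i, marginal μ i ≪ lebesgueInterval R ∧
      Integrable (llr (marginal μ i) (lebesgueInterval R)) (marginal μ i)
  · have hac' := fun i => (hm i).1
    have hsum : ∑ i, entropyInterval (marginal μ i) =
        ((-∑ i, ∫ x, llr (marginal μ i) (lebesgueInterval R) x ∂marginal μ i : ℝ) : EReal) := by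
      rw [← Finset.sum_neg_distrib, ereal_coe_sum]
      refine Finset.sum_congr rfl fun i _ => ?_
      rw [entropyInterval, entropy_eq_llr, if_pos (hm i)]
    rw [hsum, entropyBox, entropy_eq_llr]
    by_cases hac : μ ≪ lebesgueBox R n
    · have hμπ := ac_pi_marginal hac hac'
      have hllr := llr_lebesgueBox_eq hac hac'
      have hi : ∀ i, Integrable (fun x : Box R n =>
          llr (marginal μ i) (lebesgueInterval R) (x i)) μ := fun i =>
        (hm i).2.comp_measurable (measurable_pi_apply i)
      have hisum : Integrable (fun x : Box R n =>
          ∑ i, llr (marginal μ i) (lebesgueInterval R) (x i)) μ :=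
        integrable_finsetSum _ fun i _ => hi i
      have hiff : Integrable (llr μ (lebesgueBox R n)) μ ↔
          Integrable (llr μ (Measure.pi (marginal μ))) μ := by
        rw [integrable_congr hllr]
        exact integrable_add_iff_integrable_left' hisum
      by_cases hint : Integrable (llr μ (Measure.pi (marginal μ))) μ
      · rw [if_pos ⟨hac, hiff.2 hint⟩]
        have htop := InformationTheory.klDiv_ne_top hμπ hint
        rw [← EReal.coe_ennreal_toReal htop,
          InformationTheory.toReal_klDiv_of_measure_eq hμπ (by simp), ← EReal.coe_neg,
          ← EReal.coe_add, integral_congr_ae hllr, integral_add hint hisum,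
          integral_finsetSum _ fun i _ => hi i, neg_add]
        congr 3
        refine Finset.sum_congr rfl fun i _ => ?_
        rw [marginal, integral_map (measurable_pi_apply i).aemeasurable
          (stronglyMeasurable_llr _ _).aestronglyMeasurable]
      · rw [if_neg fun h => hint (hiff.1 h.2), InformationTheory.klDiv_of_not_integrable hint]
        simp
    · have hnac : ¬ μ ≪ Measure.pi (marginal μ) := fun h => hac (h.trans (by
        rw [pi_marginal_eq_withDensity hac']
        exact withDensity_absolutelyContinuous _ _))
      rw [if_neg fun h => hac h.1, InformationTheory.klDiv_of_not_ac hnac]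
      simp
  · have hbot : entropyBox μ = ⊥ := by
      rw [entropyBox, entropy_eq_llr, if_neg]
      exact fun h => hm (ac_and_integrable_marginal hR h.1 h.2)
    obtain ⟨i, hi⟩ := not_forall.1 hm
    have hsum : ∑ i, entropyInterval (marginal μ i) = ⊥ := by
      rw [← Finset.add_sum_erase _ _ (Finset.mem_univ i), entropyInterval, entropy_eq_llr,
        if_neg hi, EReal.bot_add]
    rw [hbot, hsum, EReal.add_bot]

end Entropy

theorem legendreISym_eq_klDiv {R : ℝ} {n : ℕ} (μ : Measure (Box R n)) [IsProbabilityMeasure μ]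
    {Ξ : (N : ℕ) → Fin n → Fin N → Interval R} (hΞ : IsApproximating (marginal μ) Ξ) :
    legendreISym μ Ξ =
      ((InformationTheory.klDiv μ (Measure.pi (marginal μ)) : ENNReal) : EReal) :=
  le_antisymm ((legendreISym_le_ISym μ Ξ).trans (ISym_le_klDiv μ hΞ)) (klDiv_le_legendreISym μ hΞ)

theorem ISym_eq_klDiv {R : ℝ} {n : ℕ} (μ : Measure (Box R n)) [IsProbabilityMeasure μ]
    {Ξ : (N : ℕ) → Fin n → Fin N → Interval R} (hΞ : IsApproximating (marginal μ) Ξ) :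
    ISym μ Ξ =
      ((InformationTheory.klDiv μ (Measure.pi (marginal μ)) : ENNReal) : EReal) :=
  le_antisymm (ISym_le_klDiv μ hΞ) ((klDiv_le_legendreISym μ hΞ).trans (legendreISym_le_ISym μ Ξ))

theorem eq_pi_marginal_iff_iIndepFun {R : ℝ} {n : ℕ} (μ : Measure (Box R n))
    [IsProbabilityMeasure μ] :
    μ = Measure.pi (marginal μ) ↔
      ProbabilityTheory.iIndepFun (fun (i : Fin n) (x : Box R n) => x i) μ := by
  rw [ProbabilityTheory.iIndepFun_iff_map_fun_eq_pi_map
    fun i => (measurable_pi_apply i).aemeasurable]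
  have : μ.map (fun (x : Box R n) i => x i) = μ := Measure.map_id
  rw [this]
  rfl

end MutualPressure

theorem theorem3p5 (R : ℝ) (hR : 0 < R) (n : ℕ) (hn : 1 ≤ n)
    (μ : MeasureTheory.Measure (MutualPressure.Box R n)) [MeasureTheory.IsProbabilityMeasure μ]
    (Ξ Ξ' : (N : ℕ) → Fin n → Fin N → MutualPressure.Interval R)
    (hΞ : MutualPressure.IsApproximating (MutualPressure.marginal μ) Ξ)
    (hΞ' : MutualPressure.IsApproximating (MutualPressure.marginal μ) Ξ') :
    MutualPressure.entropyBox μ =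
        -MutualPressure.legendreISym μ Ξ
          + ∑ i, MutualPressure.entropyInterval (MutualPressure.marginal μ i) ∧
    ((∀ i, ⊥ < MutualPressure.entropyInterval (MutualPressure.marginal μ i)) →
      MutualPressure.legendreISym μ Ξ = MutualPressure.ISym μ Ξ' ∧
      MutualPressure.ISym μ Ξ' =
        ((InformationTheory.klDiv μ
          (MeasureTheory.Measure.pi (MutualPressure.marginal μ)) : ENNReal) : EReal) ∧
      (MutualPressure.legendreISym μ Ξ = 0 ↔
        μ = MeasureTheory.Measure.pi (MutualPressure.marginal μ)) ∧
      (μ = MeasureTheory.Measure.pi (MutualPressure.marginal μ) ↔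
        ProbabilityTheory.iIndepFun
          (fun (i : Fin n) (x : MutualPressure.Box R n) => x i) μ)) := by
  have hprob : ∀ i, IsProbabilityMeasure (MutualPressure.marginal μ i) := fun i =>
    Measure.isProbabilityMeasure_map (measurable_pi_apply i).aemeasurable
  have hL := MutualPressure.legendreISym_eq_klDiv μ hΞ
  have hI := MutualPressure.ISym_eq_klDiv μ hΞ'
  refine ⟨by rw [hL]; exact MutualPressure.entropyBox_eq_neg_klDiv_add hR μ, fun _ =>
    ⟨hL.trans hI.symm, hI, ?_, MutualPressure.eq_pi_marginal_iff_iIndepFun μ⟩⟩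
  rw [hL, EReal.coe_ennreal_eq_zero, InformationTheory.klDiv_eq_zero_iff]
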